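/- **Setting.** Let $d\ge 1$. A *$d$-dimensional Hilbert space-filling curve* is a continuous map $H:[0,1]\to[0,1]^d$ such that for every $k\ge 0$ the images under $H$ of the $2^{dk}$ intervals $[\kappa 2^{-dk},(\kappa+1)2^{-dk}]$, $0\le\kappa<2^{dk}$, are the $2^{dk}$ closed dyadic subcubes of $[0,1]^d$ of side length $2^{-k}$, each occurring exactly once, and the subcubes belonging to consecutive $\kappa$ share a $(d-1)$-dimensional face. For points $t_1,\dots,t_N\in[0,1]^d$ the star discrepancy is $$D_N^*(t_1,\dots,t_N)=\sup_{x\in[0,1]^d}\Big|\lambda([0,x])-\frac1N\sum_{n=1}^N \mathbf 1_{[0,x]}(t_n)\Big|,$$ where $\lambda$ is Lebesgue measure and $[0,x]=\prod_{j=1}^d[0,x_j]$. **Theorem.** Let $d\ge1$ and $0\le q<1$, and put $$c(d,q)=\ln\frac{(2e)^d}{\sqrt{2\pi d}\,(1-q)} .$$ Let $b\ge1$, $m\ge1$ be integers, $N=b^m$, let $H$ be a $d$-dimensional Hilbert space-filling curve, let $E_i=H\big([\tfrac{i-1}{N},\tfrac iN]\big)$, and let $X_1,\dots,X_N$ be independent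 random points, $X_i$ being uniformly distributed on $E_i$, $i=1,\dots,N$. Then, with probability at least $q$, $$D_N^*(X_1,\dots,X_N)\le \frac{6d^{3/4}}{N^{\frac12+\frac1{2d}}}\sqrt{d\ln(N+1)+c(d,q)}+\frac{2c(d,q)}{3N}.$$ For fixed $d$ and $q$, the right-hand side is $O\big(N^{-\frac12-\frac1{2d}}\sqrt{\ln N}\big)$ as $N\to\infty$. -/

import Mathlib

open MeasureTheory ProbabilityTheory Set

/-! ### Hilbert space-filling curves -/

/-- The closed cube of side `2⁻ᵏ` in `ℝᵈ` whose lower corner is `2⁻ᵏ c`. -/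
def cubeCell {d : ℕ} (k : ℕ) (c : Fin d → ℕ) : Set (Fin d → ℝ) :=
  Icc (fun j => (c j : ℝ) / 2 ^ k) (fun j => ((c j : ℝ) + 1) / 2 ^ k)

/-- The closed interval `[κ / M, (κ + 1) / M]`. -/
def segment01 (M κ : ℕ) : Set ℝ := Icc ((κ : ℝ) / M) (((κ : ℝ) + 1) / M)

/-- Two cubes of the same grid share a `(d - 1)`-dimensional face: their lower corners differ
in exactly one coordinate, and there by one. -/
def FaceAdjacent {d : ℕ} (c c' : Fin d → ℕ) : Prop :=
  ∃ i, (c i + 1 = c' i ∨ c' i + 1 = c i) ∧ ∀ j, j ≠ i → c j = c' j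

/-- `H` (restricted to `[0, 1]`) is a `d`-dimensional Hilbert space-filling curve: it is
continuous and, for every order `k`, it maps the `2 ^ (d * k)` consecutive closed intervals of
length `2 ^ (-d * k)` onto the `2 ^ (d * k)` closed dyadic subcubes of side `2 ^ (-k)` of
`[0, 1]ᵈ`, each subcube being taken exactly once and consecutive ones sharing a face. (That the
subcubes of order `k + 1` are nested in those of order `k` follows, as they are images.)
The classical curve, built from the reflected Gray code, is `hilbertCurve` below; it satisfies
this definition by `isHilbertCurve_hilbertCurve`. -/
structure IsHilbertCurve (d : ℕ) (H : ℝ → Fin d → ℝ) : Prop where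
  continuousOn : ContinuousOn H (Icc 0 1)
  exists_cells : ∀ k : ℕ, ∃ c : ℕ → Fin d → ℕ,
    BijOn c (Iio (2 ^ (d * k))) {v | ∀ j, v j < 2 ^ k} ∧
    (∀ κ < 2 ^ (d * k), H '' segment01 (2 ^ (d * k)) κ = cubeCell k (c κ)) ∧
    ∀ κ, κ + 1 < 2 ^ (d * k) → FaceAdjacent (c κ) (c (κ + 1))

/-! ### Stratified sampling along the curve, star discrepancy, and the bound -/

/-- The stratum `H([i / N, (i + 1) / N])`; strata are numbered `i = 0, …, N - 1`. -/
def hilbertStratum {d : ℕ} (H : ℝ → Fin d → ℝ) (N i : ℕ) : Set (Fin d → ℝ) :=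
  H '' segment01 N i

/-- `X 0, …, X (N - 1)` are independent random points, `X i` being uniformly distributed on
the `i`-th stratum with respect to Lebesgue measure. -/
structure IsHilbertSample {d N : ℕ} (H : ℝ → Fin d → ℝ) {Ω : Type*} [MeasurableSpace Ω]
    (μ : Measure Ω) (X : Fin N → Ω → Fin d → ℝ) : Prop where
  measurable : ∀ i, Measurable (X i)
  indep : iIndepFun X μ
  uniform : ∀ i, pdf.IsUniform (X i) (hilbertStratum H N i) μ volume

/-- The star discrepancy
`sup_{x ∈ [0,1]ᵈ} |λ([0, x]) - (1 / N) ∑ₙ 1_{[0, x]}(P n)|` of a finite family of points. -/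
noncomputable def starDiscrepancy {d N : ℕ} (P : Fin N → Fin d → ℝ) : ℝ :=
  ⨆ x : Icc (0 : Fin d → ℝ) 1,
    |volume.real (Icc 0 (x : Fin d → ℝ)) -
      (∑ n, (Icc 0 (x : Fin d → ℝ)).indicator (fun _ => (1 : ℝ)) (P n)) / N|

/-- `c(d, q) = ln ((2e)ᵈ / (√(2πd) (1 - q)))`. -/
noncomputable def discConst (d : ℕ) (q : ℝ) : ℝ :=
  Real.log ((2 * Real.exp 1) ^ d / (√(2 * Real.pi * d) * (1 - q)))

/-- `6 d^{3/4} N^{-1/2 - 1/(2d)} √(d ln (N + 1) + c(d, q)) + 2 c(d, q) / (3 N)`. -/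
noncomputable def discBound (d : ℕ) (q : ℝ) (N : ℕ) : ℝ :=
  6 * (d : ℝ) ^ (3 / 4 : ℝ) / (N : ℝ) ^ (1 / 2 + 1 / (2 * d) : ℝ) *
      √(d * Real.log (N + 1) + discConst d q) +
    2 * discConst d q / (3 * N)

/-! ### The classical Hilbert curve in dimension `d`

The definitions and facts below construct one Hilbert curve in every dimension `d ≥ 1`
and check that it satisfies `IsHilbertCurve`. -/

set_option linter.unusedSectionVars false

/-- Bit `j` of the `w`-th word of the reflected binary Gray code. -/
def grayBit (w j : ℕ) : Bool := w.testBit j ^^ w.testBit (j + 1)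

/-- The bit in which the words `w` and `w + 1` of the Gray code differ. -/
def graySwitch (w : ℕ) : ℕ := padicValNat 2 (w + 1)

theorem grayBit_zero_right (w : ℕ) :
    grayBit w 0 = (decide (w % 2 = 1) ^^ decide (w / 2 % 2 = 1)) := by
  simp only [grayBit, Nat.testBit_succ, Nat.testBit_zero]

theorem grayBit_succ_right (w j : ℕ) : grayBit w (j + 1) = grayBit (w / 2) j := by
  simp only [grayBit, Nat.testBit_succ]

theorem graySwitch_even (u : ℕ) : graySwitch (2 * u) = 0 := by
  apply padicValNat.eq_zero_of_not_dvd; omega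

theorem graySwitch_odd (u : ℕ) : graySwitch (2 * u + 1) = graySwitch u + 1 := by
  unfold graySwitch
  rw [show 2 * u + 1 + 1 = 2 * (u + 1) by ring, padicValNat.mul (by norm_num) (by omega)]
  simp [add_comm]

theorem grayBit_succ (w j : ℕ) :
    grayBit (w + 1) j = (grayBit w j ^^ decide (j = graySwitch w)) := by
  induction w using Nat.strong_induction_on generalizing j with
  | _ w ih =>
    rcases Nat.even_or_odd' w with ⟨u, rfl | rfl⟩
    · rw [graySwitch_even]
      have e1 : (2 * u + 1) / 2 = u := by omega
      have e2 : (2 * u) / 2 = u := by omega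
      have e3 : (2 * u + 1) % 2 = 1 := by omega
      have e4 : (2 * u) % 2 = 0 := by omega
      cases j with
      | zero => rw [grayBit_zero_right, grayBit_zero_right, e1, e2, e3, e4]; simp
      | succ j => rw [grayBit_succ_right, grayBit_succ_right, e1, e2]; simp
    · rw [graySwitch_odd]
      have e1 : (2 * u + 1 + 1) / 2 = u + 1 := by omega
      have e2 : (2 * u + 1) / 2 = u := by omega
      have e3 : (2 * u + 1 + 1) % 2 = 0 := by omega
      have e4 : (2 * u + 1) % 2 = 1 := by omega
      cases j with
      | zero =>
        rw [grayBit_zero_right, grayBit_zero_right, e1, e2, e3, e4]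
        rcases Nat.mod_two_eq_zero_or_one u with h | h
        · have : (u + 1) % 2 = 1 := by omega
          simp [h, this]
        · have : (u + 1) % 2 = 0 := by omega
          simp [h, this]
      | succ j =>
        rw [grayBit_succ_right, grayBit_succ_right, e1, e2, ih u (by omega) j]; simp

theorem grayBit_of_lt {d w j : ℕ} (hw : w < 2 ^ d) (hj : d ≤ j) : grayBit w j = false := by
  have h1 : w < 2 ^ j := hw.trans_le (Nat.pow_le_pow_right (by norm_num) hj)
  have h2 : w < 2 ^ (j + 1) := h1.trans_le (Nat.pow_le_pow_right (by norm_num) (by omega))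
  simp [grayBit, Nat.testBit_lt_two_pow h1, Nat.testBit_lt_two_pow h2]

theorem graySwitch_lt {d w : ℕ} (hw : w + 1 < 2 ^ d) : graySwitch w < d := by
  by_contra! h
  have := grayBit_succ w (graySwitch w)
  rw [grayBit_of_lt hw h, grayBit_of_lt (by omega) h] at this
  simp at this

theorem grayBit_inj {d : ℕ} : ∀ {w w' : ℕ}, w < 2 ^ d → w' < 2 ^ d →
    (∀ j < d, grayBit w j = grayBit w' j) → w = w' := by
  induction d with
  | zero => intro w w' h h' _; simp at h h'; omega
  | succ d ih =>
    intro w w' h h' hj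
    have key : w / 2 = w' / 2 := by
      apply ih (by omega) (by omega)
      intro j hjd
      have := hj (j + 1) (by omega)
      rwa [grayBit_succ_right, grayBit_succ_right] at this
    have h0 := hj 0 (by omega)
    rw [grayBit_zero_right, grayBit_zero_right, key] at h0
    have h1 : (w % 2 = 1) ↔ (w' % 2 = 1) := by simpa using h0
    omega

/-- Entry corner of the `w`-th subcube of the order-one curve, in local coordinates. -/
def grayEntry (w j : ℕ) : Bool := if w = 0 then false else grayBit (2 * ((w - 1) / 2)) j

/-- The axis along which the curve moves, from entry to exit corner, inside the `w`-th
subcube of the order-one curve, in local coordinates. -/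
def grayAxis (d w : ℕ) : ℕ :=
  if w = 0 then 0 else if w % 2 = 0 then graySwitch (w - 1) % d else graySwitch w % d

theorem gray_meet {d w : ℕ} (hw : w + 1 < 2 ^ d) (j : ℕ) :
    (grayBit w j).toNat + (grayEntry w j ^^ decide (j = grayAxis d w)).toNat =
      (grayBit (w + 1) j).toNat + (grayEntry (w + 1) j).toNat := by
  have hs : graySwitch w < d := graySwitch_lt hw
  rcases Nat.eq_zero_or_pos w with rfl | hpos
  · have h1 := grayBit_succ 0 j
    have h0 : ∀ j, grayBit 0 j = false := fun j => by simp [grayBit]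
    have hs : graySwitch 0 = 0 := by simp [graySwitch]
    rw [h1, hs]
    simp [grayEntry, grayAxis, h0]
  have hs' : graySwitch (w - 1) < d := graySwitch_lt (by omega)
  rcases Nat.even_or_odd' w with ⟨u, rfl | rfl⟩
  · obtain ⟨k, rfl⟩ : ∃ k, u = k + 1 := ⟨u - 1, by omega⟩
    have b1 := grayBit_succ (2 * k) j
    have b2 := grayBit_succ (2 * k + 1) j
    have b3 := grayBit_succ (2 * (k + 1)) j
    rw [graySwitch_even] at b1 b3
    have e : 2 * (k + 1) - 1 = 2 * k + 1 := by omega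
    have a : grayAxis d (2 * (k + 1)) = graySwitch (2 * k + 1) := by
      rw [grayAxis, if_neg (by omega), if_pos (by omega), e, Nat.mod_eq_of_lt (by rwa [e] at hs')]
    have c1 : grayEntry (2 * (k + 1)) j = grayBit (2 * k) j := by
      rw [grayEntry, if_neg (by omega)]; congr 1; omega
    have c2 : grayEntry (2 * (k + 1) + 1) j = grayBit (2 * (k + 1)) j := by
      rw [grayEntry, if_neg (by omega)]; congr 1; omega
    rw [a, c1, c2, b3, show 2 * (k + 1) = 2 * k + 1 + 1 by ring, b2, b1]
    generalize grayBit (2 * k) j = x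
    generalize decide (j = 0) = y
    generalize decide (j = graySwitch (2 * k + 1)) = z
    revert x y z; decide
  · have b1 := grayBit_succ (2 * u) j
    have b2 := grayBit_succ (2 * u + 1) j
    rw [graySwitch_even] at b1
    have a : grayAxis d (2 * u + 1) = graySwitch (2 * u + 1) := by
      rw [grayAxis, if_neg (by omega), if_neg (by omega), Nat.mod_eq_of_lt hs]
    have c1 : grayEntry (2 * u + 1) j = grayBit (2 * u) j := by
      rw [grayEntry, if_neg (by omega)]; congr 1; omega
    have c2 : grayEntry (2 * u + 1 + 1) j = grayBit (2 * u) j := by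
      rw [grayEntry, if_neg (by omega)]; congr 1; omega
    rw [a, c1, c2, b2, b1, graySwitch_odd]
    generalize grayBit (2 * u) j = x
    by_cases h0 : j = 0
    · subst h0; simp
    · by_cases h1 : j = graySwitch u + 1
      · simp only [decide_eq_false h0, decide_eq_true h1]; revert x; decide
      · simp only [decide_eq_false h0, decide_eq_false h1]; revert x; decide

theorem grayBit_last {d : ℕ} (hd : 1 ≤ d) (j : ℕ) (hj : j < d) :
    grayBit (2 ^ d - 1) j = decide (j = d - 1) := by
  simp only [grayBit, Nat.testBit_two_pow_sub_one]
  by_cases h : j = d - 1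
  · have h2 : ¬ (j + 1 < d) := by omega
    simp [h]; omega
  · have h2 : (j + 1 < d) := by omega
    simp [h, hj, h2]

theorem graySwitch_last (d : ℕ) : graySwitch (2 ^ d - 1) = d := by
  rw [graySwitch, Nat.sub_add_cancel Nat.one_le_two_pow, padicValNat.prime_pow]

theorem gray_exit_last {d : ℕ} (hd : 1 ≤ d) (j : ℕ) :
    (grayEntry (2 ^ d - 1) j ^^ decide (j = grayAxis d (2 ^ d - 1))) = grayBit (2 ^ d - 1) j := by
  obtain ⟨n, rfl⟩ : ∃ n, d = n + 1 := ⟨d - 1, by omega⟩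
  have hp : 1 ≤ 2 ^ n := Nat.one_le_two_pow
  have e : 2 ^ (n + 1) - 1 = 2 * (2 ^ n - 1) + 1 := by rw [pow_succ]; omega
  have a : grayAxis (n + 1) (2 ^ (n + 1) - 1) = 0 := by
    rw [grayAxis, if_neg (by omega), if_neg (by omega), graySwitch_last, Nat.mod_self]
  rw [a, e, grayBit_succ, graySwitch_even, grayEntry, if_neg (by omega)]
  congr 2; omega

/-- Orientation of the curve inside a cube: it enters at the corner `entry` and leaves at the
corner that differs from it in the coordinate `axis`. -/
structure HilbertState (d : ℕ) where
  entry : Fin d → Bool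
  axis : Fin d

/-- The exit corner. -/
def HilbertState.exit {d : ℕ} (s : HilbertState d) (j : Fin d) : Bool :=
  s.entry j ^^ decide (j = s.axis)

/-- Position of the `w`-th subcube visited inside a cube with orientation `s`. -/
def HilbertState.subcube {d : ℕ} [NeZero d] (s : HilbertState d) (w : ℕ) (j : Fin d) : Bool :=
  s.entry j ^^ grayBit w (j - s.axis - 1).val

/-- Orientation of the curve inside the `w`-th subcube. -/
def HilbertState.child {d : ℕ} [NeZero d] (s : HilbertState d) (w : ℕ) : HilbertState d where
  entry j := s.entry j ^^ grayEntry w (j - s.axis - 1).val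
  axis := Fin.ofNat d (grayAxis d w) + s.axis + 1

/-- Lower corner (in units of `2⁻ᵏ`) and orientation of the `κ`-th cube of order `k`. -/
def hilbertNode (d : ℕ) [NeZero d] : ℕ → ℕ → (Fin d → ℕ) × HilbertState d
  | 0, _ => (fun _ => 0, ⟨fun _ => false, 0⟩)
  | k + 1, κ =>
    let p := hilbertNode d k (κ / 2 ^ d)
    (fun j => 2 * p.1 j + (p.2.subcube (κ % 2 ^ d) j).toNat, p.2.child (κ % 2 ^ d))

section
variable {d : ℕ} [NeZero d]

theorem grayAxis_lt (w : ℕ) : grayAxis d w < d := by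
  have : 0 < d := Nat.pos_of_neZero d
  unfold grayAxis
  split_ifs
  · exact this
  · exact Nat.mod_lt _ this
  · exact Nat.mod_lt _ this

theorem local_index_iff (a j : Fin d) {n : ℕ} (hn : n < d) :
    (j - a - 1).val = n ↔ j = Fin.ofNat d n + a + 1 := by
  have h : Fin.ofNat d n = (⟨n, hn⟩ : Fin d) := by
    ext; simp [Nat.mod_eq_of_lt hn]
  rw [h]
  constructor
  · intro h'
    have : j - a - 1 = (⟨n, hn⟩ : Fin d) := Fin.ext h'
    rw [← this]; abel
  · intro h'
    have : j - a - 1 = (⟨n, hn⟩ : Fin d) := by rw [h']; abel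
    rw [this]

theorem HilbertState.exit_child (s : HilbertState d) (w : ℕ) (j : Fin d) :
    (s.child w).exit j = (s.entry j ^^ (grayEntry w (j - s.axis - 1).val ^^
      decide ((j - s.axis - 1).val = grayAxis d w))) := by
  have : decide ((j - s.axis - 1).val = grayAxis d w) =
      decide (j = Fin.ofNat d (grayAxis d w) + s.axis + 1) :=
    decide_eq_decide.mpr (local_index_iff _ _ (grayAxis_lt w))
  rw [this]
  exact Bool.xor_assoc _ _ _

theorem HilbertState.subcube_zero (s : HilbertState d) (j : Fin d) :
    s.subcube 0 j = s.entry j := by simp [HilbertState.subcube, grayBit]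

theorem HilbertState.entry_child_zero (s : HilbertState d) (j : Fin d) :
    (s.child 0).entry j = s.entry j := by simp [HilbertState.child, grayEntry]

theorem HilbertState.subcube_last (s : HilbertState d) (j : Fin d) :
    s.subcube (2 ^ d - 1) j = s.exit j := by
  have hd : 0 < d := Nat.pos_of_neZero d
  have h1 : Fin.ofNat d (d - 1) + s.axis + 1 = s.axis := by
    obtain ⟨n, rfl⟩ : ∃ n, d = n + 1 := ⟨d - 1, by omega⟩
    have : Fin.ofNat (n + 1) (n + 1 - 1) = -1 := by
      rw [eq_neg_iff_add_eq_zero]; ext; simp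
    rw [this]; abel
  have : decide ((j - s.axis - 1).val = d - 1) = decide (j = s.axis) :=
    decide_eq_decide.mpr (by rw [local_index_iff _ _ (by omega), h1])
  rw [HilbertState.subcube, HilbertState.exit, grayBit_last hd _ (j - s.axis - 1).isLt, this]

theorem HilbertState.exit_child_last (s : HilbertState d) (j : Fin d) :
    (s.child (2 ^ d - 1)).exit j = s.exit j := by
  rw [HilbertState.exit_child, gray_exit_last (Nat.pos_of_neZero d), ← HilbertState.subcube_last]
  rfl

theorem HilbertState.meet (s : HilbertState d) {w : ℕ} (hw : w + 1 < 2 ^ d) (j : Fin d) :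
    (s.subcube w j).toNat + ((s.child w).exit j).toNat =
      (s.subcube (w + 1) j).toNat + ((s.child (w + 1)).entry j).toNat := by
  have := gray_meet hw (j - s.axis - 1).val
  rw [HilbertState.exit_child, HilbertState.subcube, HilbertState.subcube, HilbertState.child]
  revert this
  dsimp only
  generalize grayBit w (j - s.axis - 1).val = x
  generalize grayBit (w + 1) (j - s.axis - 1).val = y
  generalize (grayEntry w (j - s.axis - 1).val ^^
      decide ((j - s.axis - 1).val = grayAxis d w)) = z
  generalize grayEntry (w + 1) (j - s.axis - 1).val = t
  generalize s.entry j = e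
  revert x y z t e; decide

theorem HilbertState.subcube_succ (s : HilbertState d) {w : ℕ} (hw : w + 1 < 2 ^ d) :
    ∃ i, ∀ j, s.subcube (w + 1) j = (s.subcube w j ^^ decide (j = i)) := by
  refine ⟨Fin.ofNat d (graySwitch w) + s.axis + 1, fun j => ?_⟩
  have : decide ((j - s.axis - 1).val = graySwitch w) =
      decide (j = Fin.ofNat d (graySwitch w) + s.axis + 1) :=
    decide_eq_decide.mpr (local_index_iff _ _ (graySwitch_lt hw))
  rw [HilbertState.subcube, grayBit_succ, this, HilbertState.subcube]; simp

theorem HilbertState.subcube_inj (s : HilbertState d) {w w' : ℕ} (hw : w < 2 ^ d)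
    (hw' : w' < 2 ^ d) (h : ∀ j, s.subcube w j = s.subcube w' j) : w = w' := by
  refine grayBit_inj hw hw' fun j hj => ?_
  have h' := h (Fin.ofNat d j + s.axis + 1)
  have e : (Fin.ofNat d j + s.axis + 1 - s.axis - 1).val = j :=
    (local_index_iff _ _ hj).mpr rfl
  rw [HilbertState.subcube, HilbertState.subcube, e] at h'
  simpa using h'

theorem hilbertNode_lt (k κ : ℕ) (j : Fin d) : (hilbertNode d k κ).1 j < 2 ^ k := by
  induction k generalizing κ with
  | zero => simp [hilbertNode]
  | succ k ih =>
    have := ih (κ / 2 ^ d)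
    have h2 : ∀ b : Bool, b.toNat ≤ 1 := by decide
    have h3 := h2 ((hilbertNode d k (κ / 2 ^ d)).2.subcube (κ % 2 ^ d) j)
    simp only [hilbertNode, pow_succ]; omega

theorem hilbertNode_inj (k : ℕ) {κ κ' : ℕ} (h : κ < 2 ^ (d * k)) (h' : κ' < 2 ^ (d * k))
    (he : (hilbertNode d k κ).1 = (hilbertNode d k κ').1) : κ = κ' := by
  induction k generalizing κ κ' with
  | zero => simp at h h'; omega
  | succ k ih =>
    have hp : 2 ^ (d * (k + 1)) = 2 ^ d * 2 ^ (d * k) := by rw [← pow_add]; congr 1; ring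
    rw [hp] at h h'
    have h2 : ∀ b b' : Bool, ∀ n n', 2 * n + b.toNat = 2 * n' + b'.toNat → n = n' ∧ b = b' := by
      intro b b' n n' h; cases b <;> cases b' <;> simp at h ⊢ <;> omega
    have h3 := fun j => h2 _ _ _ _ (congrFun he j)
    have h4 : κ / 2 ^ d = κ' / 2 ^ d :=
      ih (Nat.div_lt_of_lt_mul h) (Nat.div_lt_of_lt_mul h') (funext fun j => (h3 j).1)
    have h5 : κ % 2 ^ d = κ' % 2 ^ d := by
      have h6 := fun j => (h3 j).2
      rw [h4] at h6
      exact HilbertState.subcube_inj _ (Nat.mod_lt _ (by positivity)) (Nat.mod_lt _ (by positivity)) h6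
    rw [← Nat.div_add_mod κ (2 ^ d), ← Nat.div_add_mod κ' (2 ^ d), h4, h5]

theorem hilbertNode_bijOn (k : ℕ) :
    BijOn (fun κ => (hilbertNode d k κ).1) (Iio (2 ^ (d * k))) {v | ∀ j, v j < 2 ^ k} := by
  have hinj : InjOn (fun κ => (hilbertNode d k κ).1) (Iio (2 ^ (d * k))) :=
    fun κ h κ' h' he => hilbertNode_inj k h h' he
  refine ⟨fun κ _ j => hilbertNode_lt k κ j, hinj, ?_⟩
  have hset : {v : Fin d → ℕ | ∀ j, v j < 2 ^ k} =
      ↑(Fintype.piFinset fun _ : Fin d => Finset.range (2 ^ k)) := by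
    ext v; simp
  have hsub : (Finset.range (2 ^ (d * k))).image (fun κ => (hilbertNode d k κ).1) =
      Fintype.piFinset fun _ : Fin d => Finset.range (2 ^ k) := by
    apply Finset.eq_of_subset_of_card_le
    · intro v hv
      simp only [Finset.mem_image, Finset.mem_range] at hv
      obtain ⟨κ, -, rfl⟩ := hv
      simpa using fun j => hilbertNode_lt k κ j
    · rw [Finset.card_image_of_injOn (by simpa using hinj)]
      simp [← pow_mul, mul_comm]
  intro v hv
  rw [hset, ← hsub] at hv
  simpa using hv

theorem hilbertNode_succ (k κ w : ℕ) (hw : w < 2 ^ d) :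
    hilbertNode d (k + 1) (κ * 2 ^ d + w) =
      (fun j => 2 * (hilbertNode d k κ).1 j + ((hilbertNode d k κ).2.subcube w j).toNat,
        (hilbertNode d k κ).2.child w) := by
  have h1 : (κ * 2 ^ d + w) / 2 ^ d = κ := by
    rw [add_comm, Nat.add_mul_div_right _ _ (by positivity), Nat.div_eq_of_lt hw, zero_add]
  have h2 : (κ * 2 ^ d + w) % 2 ^ d = w := by
    rw [add_comm, Nat.add_mul_mod_self_right, Nat.mod_eq_of_lt hw]
  simp only [hilbertNode, h1, h2]

theorem hilbertNode_adj (k κ : ℕ) (h : κ + 1 < 2 ^ (d * k)) :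
    FaceAdjacent (hilbertNode d k κ).1 (hilbertNode d k (κ + 1)).1 ∧
    ∀ j, (hilbertNode d k κ).1 j + ((hilbertNode d k κ).2.exit j).toNat =
      (hilbertNode d k (κ + 1)).1 j + ((hilbertNode d k (κ + 1)).2.entry j).toNat := by
  induction k generalizing κ with
  | zero => simp at h
  | succ k ih =>
    have hp : 2 ^ (d * (k + 1)) = 2 ^ d * 2 ^ (d * k) := by rw [← pow_add]; congr 1; ring
    have hP : 0 < 2 ^ d := by positivity
    have hκ : κ = κ / 2 ^ d * 2 ^ d + κ % 2 ^ d := (Nat.div_add_mod' κ (2 ^ d)).symm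
    have hw : κ % 2 ^ d < 2 ^ d := Nat.mod_lt _ hP
    generalize κ / 2 ^ d = q at hκ
    generalize κ % 2 ^ d = w at hκ hw
    subst hκ
    by_cases hw1 : w + 1 < 2 ^ d
    · rw [add_assoc, hilbertNode_succ k q w hw, hilbertNode_succ k q (w + 1) hw1]
      set p := hilbertNode d k q
      constructor
      · obtain ⟨i, hi⟩ := p.2.subcube_succ hw1
        refine ⟨i, ?_, fun j hj => ?_⟩
        · simp only [hi i]
          cases p.2.subcube w i <;> simp
        · simp [hi j, hj]
      · intro j
        have := p.2.meet hw1 j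
        dsimp only
        omega
    · have hw2 : w = 2 ^ d - 1 := by omega
      have e : q * 2 ^ d + w + 1 = (q + 1) * 2 ^ d + 0 := by rw [add_mul]; omega
      have hq : q + 1 < 2 ^ (d * k) := by
        have : (q + 1) * 2 ^ d < 2 ^ (d * k) * 2 ^ d := by
          rw [hp, mul_comm (2 ^ d), add_assoc, hw2, Nat.sub_add_cancel Nat.one_le_two_pow] at h
          rwa [add_mul, one_mul]
        exact Nat.lt_of_mul_lt_mul_right this
      rw [e, hilbertNode_succ k q w hw, hilbertNode_succ k (q + 1) 0 hP]
      obtain ⟨⟨i, hi, hij⟩, hm⟩ := ih q hq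
      subst hw2
      dsimp only
      constructor
      · refine ⟨i, ?_, fun j hj => ?_⟩
        · have := hm i
          simp only [HilbertState.subcube_last, HilbertState.subcube_zero]
          omega
        · have := hm j
          have := hij j hj
          simp only [HilbertState.subcube_last, HilbertState.subcube_zero]
          omega
      · intro j
        have := hm j
        rw [HilbertState.subcube_last, HilbertState.subcube_zero, HilbertState.exit_child_last,
          HilbertState.entry_child_zero]
        omega

end

/-- The index of an order-`k` interval that contains `t`. -/
noncomputable def hilbertIndex (d k : ℕ) (t : ℝ) : ℕ :=
  min ⌊t * 2 ^ (d * k)⌋₊ (2 ^ (d * k) - 1)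

/-- The classical Hilbert curve: the common point of the nested cubes that are visited at
time `t`, as the supremum of their lower corners. -/
noncomputable def hilbertCurve (d : ℕ) [NeZero d] (t : ℝ) (j : Fin d) : ℝ :=
  ⨆ k : ℕ, ((hilbertNode d k (hilbertIndex d k t)).1 j : ℝ) / 2 ^ k

section
variable {d : ℕ} [NeZero d]

theorem two_pow_mul_succ (d k : ℕ) : 2 ^ (d * (k + 1)) = 2 ^ (d * k) * 2 ^ d := by
  rw [← pow_add]; congr 1

theorem hilbertIndex_lt (k : ℕ) (t : ℝ) : hilbertIndex d k t < 2 ^ (d * k) :=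
  (min_le_right _ _).trans_lt (Nat.sub_lt (by positivity) one_pos)

theorem hilbertIndex_succ_div (k : ℕ) (t : ℝ) :
    hilbertIndex d (k + 1) t / 2 ^ d = hilbertIndex d k t := by
  have hmono : Monotone fun n : ℕ => n / 2 ^ d := fun a b h => Nat.div_le_div_right h
  have h : min ⌊t * 2 ^ (d * (k + 1))⌋₊ (2 ^ (d * (k + 1)) - 1) / 2 ^ d =
      min (⌊t * 2 ^ (d * (k + 1))⌋₊ / 2 ^ d) ((2 ^ (d * (k + 1)) - 1) / 2 ^ d) :=
    hmono.map_min
  rw [hilbertIndex, hilbertIndex, h]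
  congr 1
  · rw [← Nat.floor_div_natCast]
    congr 1
    rw [mul_add, mul_one, pow_add]; push_cast; field_simp
  · have hA : 0 < 2 ^ (d * k) := by positivity
    have hB : 0 < 2 ^ d := by positivity
    rw [two_pow_mul_succ]
    generalize 2 ^ (d * k) = A at *
    generalize 2 ^ d = B at *
    obtain ⟨a, rfl⟩ : ∃ a, A = a + 1 := ⟨A - 1, by omega⟩
    rw [show (a + 1) * B - 1 = (B - 1) + a * B by rw [add_mul]; omega,
      Nat.add_mul_div_right _ _ hB, Nat.div_eq_of_lt (by omega)]
    simp

theorem mem_segment01 {k : ℕ} {t : ℝ} (ht : t ∈ Icc (0 : ℝ) 1) :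
    t ∈ segment01 (2 ^ (d * k)) (hilbertIndex d k t) := by
  have hM : (0 : ℝ) < 2 ^ (d * k) := by positivity
  have h0 : 0 ≤ t * 2 ^ (d * k) := mul_nonneg ht.1 hM.le
  have h1 := Nat.floor_le h0
  have h2 := Nat.lt_floor_add_one (t * 2 ^ (d * k))
  constructor
  · push_cast
    rw [div_le_iff₀ hM]
    refine le_trans ?_ h1
    exact Nat.cast_le.mpr (min_le_left _ _)
  · push_cast
    rw [le_div_iff₀ hM]
    rcases le_total ⌊t * 2 ^ (d * k)⌋₊ (2 ^ (d * k) - 1) with h | h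
    · rw [hilbertIndex, min_eq_left h]; exact h2.le
    · rw [hilbertIndex, min_eq_right h]
      push_cast [Nat.one_le_two_pow]
      nlinarith [ht.2]

theorem hilbertIndex_of_mem {k κ : ℕ} (hκ : κ < 2 ^ (d * k)) {t : ℝ}
    (ht : t ∈ segment01 (2 ^ (d * k)) κ) :
    hilbertIndex d k t = κ ∨ (κ + 1 < 2 ^ (d * k) ∧ t = ((κ + 1 : ℕ) : ℝ) / 2 ^ (d * k)) := by
  have hM : (0 : ℝ) < 2 ^ (d * k) := by positivity
  obtain ⟨h1, h2⟩ := ht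
  push_cast at h1 h2
  rw [div_le_iff₀ hM] at h1
  rw [le_div_iff₀ hM] at h2
  have hf : κ ≤ ⌊t * 2 ^ (d * k)⌋₊ := Nat.le_floor h1
  rcases h2.lt_or_eq with h | h
  · left
    have : ⌊t * 2 ^ (d * k)⌋₊ < κ + 1 := by
      rw [Nat.floor_lt' (by omega)]; exact_mod_cast h
    rw [hilbertIndex]; omega
  · by_cases hl : κ + 1 < 2 ^ (d * k)
    · right
      refine ⟨hl, ?_⟩
      rw [eq_div_iff hM.ne', h]; push_cast; rfl
    · left; rw [hilbertIndex]; omega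

theorem hilbertIndex_grid {k κ : ℕ} (hκ : κ < 2 ^ (d * k)) :
    hilbertIndex d k ((κ : ℝ) / 2 ^ (d * k)) = κ := by
  rw [hilbertIndex, div_mul_cancel₀ _ (by positivity), Nat.floor_natCast]; omega

theorem cubeCell_child_subset {k : ℕ} {c c' : Fin d → ℕ}
    (h : ∀ j, c' j = 2 * c j ∨ c' j = 2 * c j + 1) : cubeCell (k + 1) c' ⊆ cubeCell k c := by
  apply Icc_subset_Icc
  · intro j
    dsimp only
    rw [div_le_div_iff₀ (by positivity) (by positivity), pow_succ]
    have hp : (0 : ℝ) < 2 ^ k := by positivity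
    rcases h j with h | h <;> rw [h] <;> push_cast <;> nlinarith
  · intro j
    dsimp only
    rw [div_le_div_iff₀ (by positivity) (by positivity), pow_succ]
    have hp : (0 : ℝ) < 2 ^ k := by positivity
    rcases h j with h | h <;> rw [h] <;> push_cast <;> nlinarith

theorem hilbertNode_succ_cases (k κ : ℕ) (j : Fin d) :
    (hilbertNode d (k + 1) κ).1 j = 2 * (hilbertNode d k (κ / 2 ^ d)).1 j ∨
    (hilbertNode d (k + 1) κ).1 j = 2 * (hilbertNode d k (κ / 2 ^ d)).1 j + 1 := by
  simp only [hilbertNode]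
  cases (hilbertNode d k (κ / 2 ^ d)).2.subcube (κ % 2 ^ d) j <;> simp

theorem hilbertNode_cell_antitone (t : ℝ) :
    Antitone fun k => cubeCell k (hilbertNode d k (hilbertIndex d k t)).1 := by
  refine antitone_nat_of_succ_le fun k => ?_
  apply cubeCell_child_subset
  intro j
  have := hilbertNode_succ_cases (d := d) k (hilbertIndex d (k + 1) t) j
  rwa [hilbertIndex_succ_div] at this

theorem cubeCell_lower_mem {k : ℕ} (c : Fin d → ℕ) :
    (fun j => (c j : ℝ) / 2 ^ k) ∈ cubeCell k c := by
  refine ⟨le_rfl, fun j => ?_⟩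
  dsimp only
  gcongr; linarith

theorem hilbertCurve_mem (t : ℝ) (k : ℕ) :
    hilbertCurve d t ∈ cubeCell k (hilbertNode d k (hilbertIndex d k t)).1 := by
  have hle : ∀ m j, ((hilbertNode d m (hilbertIndex d m t)).1 j : ℝ) / 2 ^ m ≤
      (((hilbertNode d k (hilbertIndex d k t)).1 j : ℝ) + 1) / 2 ^ k := by
    intro m j
    have h1 := hilbertNode_cell_antitone t (le_max_left m k)
      (cubeCell_lower_mem (hilbertNode d (max m k) (hilbertIndex d (max m k) t)).1)
    have h2 := hilbertNode_cell_antitone t (le_max_right m k)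
      (cubeCell_lower_mem (hilbertNode d (max m k) (hilbertIndex d (max m k) t)).1)
    exact (h1.1 j).trans (h2.2 j)
  refine ⟨fun j => ?_, fun j => ciSup_le fun m => hle m j⟩
  exact le_ciSup (f := fun m => ((hilbertNode d m (hilbertIndex d m t)).1 j : ℝ) / 2 ^ m)
    ⟨_, by rintro _ ⟨m, rfl⟩; exact hle m j⟩ k

theorem abs_sub_le_of_mem_cubeCell {k : ℕ} {c : Fin d → ℕ} {x y : Fin d → ℝ}
    (hx : x ∈ cubeCell k c) (hy : y ∈ cubeCell k c) (j : Fin d) :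
    |x j - y j| ≤ (1 / 2) ^ k := by
  have h1 := hx.1 j
  have h2 := hx.2 j
  have h3 := hy.1 j
  have h4 := hy.2 j
  dsimp only at h1 h2 h3 h4
  rw [add_div] at h2 h4
  rw [one_div_pow, abs_le]
  constructor <;> linarith

theorem eq_of_forall_mem_cubeCell {x y : Fin d → ℝ} (k : ℕ) (c : ℕ → Fin d → ℕ)
    (h : ∀ m, x ∈ cubeCell (k + m) (c m) ∧ y ∈ cubeCell (k + m) (c m)) : x = y := by
  funext j
  by_contra hne
  have hpos : 0 < |x j - y j| := abs_pos.mpr (sub_ne_zero.mpr hne)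
  obtain ⟨m, hm⟩ := exists_pow_lt_of_lt_one hpos (by norm_num : (1 / 2 : ℝ) < 1)
  have h1 := abs_sub_le_of_mem_cubeCell (h m).1 (h m).2 j
  have h2 : (1 / 2 : ℝ) ^ (k + m) ≤ (1 / 2) ^ m :=
    pow_le_pow_of_le_one (by norm_num) (by norm_num) (by omega)
  linarith

theorem hilbertNode_entry (k κ m : ℕ) (j : Fin d) :
    (hilbertNode d (k + m) (κ * 2 ^ (d * m))).1 j +
      ((hilbertNode d (k + m) (κ * 2 ^ (d * m))).2.entry j).toNat =
    2 ^ m * ((hilbertNode d k κ).1 j + ((hilbertNode d k κ).2.entry j).toNat) := by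
  induction m with
  | zero => simp
  | succ m ih =>
    have e : κ * 2 ^ (d * (m + 1)) = κ * 2 ^ (d * m) * 2 ^ d + 0 := by
      rw [two_pow_mul_succ]; ring
    rw [e, ← add_assoc, hilbertNode_succ _ _ 0 (by positivity)]
    dsimp only
    rw [HilbertState.subcube_zero, HilbertState.entry_child_zero, pow_succ]
    linarith

theorem corner_mem_cubeCell {k : ℕ} (c : Fin d → ℕ) (b : Fin d → Bool) :
    (fun j => ((c j + (b j).toNat : ℕ) : ℝ) / 2 ^ k) ∈ cubeCell k c := by
  refine ⟨fun j => ?_, fun j => ?_⟩ <;> dsimp only <;> gcongr <;> cases b j <;> simp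

theorem hilbertCurve_grid {k κ : ℕ} (hκ : κ < 2 ^ (d * k)) :
    hilbertCurve d ((κ : ℝ) / 2 ^ (d * k)) = fun j =>
      (((hilbertNode d k κ).1 j + ((hilbertNode d k κ).2.entry j).toNat : ℕ) : ℝ) / 2 ^ k := by
  refine eq_of_forall_mem_cubeCell k
    (fun m => (hilbertNode d (k + m) (κ * 2 ^ (d * m))).1) fun m => ⟨?_, ?_⟩
  · have h1 := hilbertCurve_mem (d := d) ((κ : ℝ) / 2 ^ (d * k)) (k + m)
    have h2 : ((κ : ℝ) / 2 ^ (d * k)) =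
        ((κ * 2 ^ (d * m) : ℕ) : ℝ) / 2 ^ (d * (k + m)) := by
      rw [mul_add, pow_add]; push_cast; field_simp
    rw [h2, hilbertIndex_grid] at h1
    · rw [h2]; exact h1
    · rw [mul_add, pow_add]; gcongr
  · have h1 := corner_mem_cubeCell (k := k + m) (hilbertNode d (k + m) (κ * 2 ^ (d * m))).1
      (hilbertNode d (k + m) (κ * 2 ^ (d * m))).2.entry
    simp only [hilbertNode_entry] at h1
    convert h1 using 2 with j
    rw [pow_add]; push_cast; field_simp

theorem hilbertCurve_mem_of_mem {k κ : ℕ} (hκ : κ < 2 ^ (d * k)) {t : ℝ}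
    (ht : t ∈ segment01 (2 ^ (d * k)) κ) :
    hilbertCurve d t ∈ cubeCell k (hilbertNode d k κ).1 := by
  rcases hilbertIndex_of_mem hκ ht with h | ⟨h1, rfl⟩
  · have := hilbertCurve_mem (d := d) t k
    rwa [h] at this
  · rw [hilbertCurve_grid h1]
    have h2 := (hilbertNode_adj (d := d) k κ h1).2
    have h3 := corner_mem_cubeCell (k := k) (hilbertNode d k κ).1 (hilbertNode d k κ).2.exit
    simpa only [h2] using h3

theorem exists_subcube (s : HilbertState d) (b : Fin d → Bool) :
    ∃ w < 2 ^ d, ∀ j, s.subcube w j = b j := by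
  have hb : Function.Bijective fun (w : Fin (2 ^ d)) (j : Fin d) => s.subcube w.val j := by
    rw [Fintype.bijective_iff_injective_and_card]
    exact ⟨fun w w' h => Fin.ext (s.subcube_inj w.isLt w'.isLt (congrFun h)), by simp⟩
  obtain ⟨w, hw⟩ := hb.2 b
  exact ⟨w, w.isLt, congrFun hw⟩

theorem exists_child_mem {k κ : ℕ} {x : Fin d → ℝ} (hκ : κ < 2 ^ (d * k))
    (hx : x ∈ cubeCell k (hilbertNode d k κ).1) :
    ∃ κ' < 2 ^ (d * (k + 1)), κ' / 2 ^ d = κ ∧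
      x ∈ cubeCell (k + 1) (hilbertNode d (k + 1) κ').1 := by
  set c := (hilbertNode d k κ).1 with hc
  obtain ⟨w, hw, hwb⟩ := exists_subcube (hilbertNode d k κ).2
    (fun j => decide ((2 * (c j : ℝ) + 1) / 2 ^ (k + 1) ≤ x j))
  refine ⟨κ * 2 ^ d + w, ?_, ?_, ?_⟩
  · rw [two_pow_mul_succ]
    have : (κ + 1) * 2 ^ d ≤ 2 ^ (d * k) * 2 ^ d := Nat.mul_le_mul_right _ hκ
    rw [add_mul, one_mul] at this
    omega
  · rw [add_comm, Nat.add_mul_div_right _ _ (by positivity), Nat.div_eq_of_lt hw, zero_add]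
  · rw [hilbertNode_succ k κ w hw, ← hc]
    have hx1 : ∀ j, (2 * (c j : ℝ)) / 2 ^ (k + 1) ≤ x j := fun j => by
      refine le_trans (le_of_eq ?_) (hx.1 j)
      rw [pow_succ]; field_simp
    have hx2 : ∀ j, x j ≤ (2 * (c j : ℝ) + 2) / 2 ^ (k + 1) := fun j => by
      refine (hx.2 j).trans (le_of_eq ?_)
      rw [pow_succ]; field_simp
    constructor <;> intro j <;> dsimp only <;> rw [hwb j]
    · by_cases h : (2 * (c j : ℝ) + 1) / 2 ^ (k + 1) ≤ x j
      · simpa [h] using h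
      · simpa [h] using hx1 j
    · by_cases h : (2 * (c j : ℝ) + 1) / 2 ^ (k + 1) ≤ x j
      · refine (hx2 j).trans (le_of_eq ?_)
        simp [h]; ring
      · simpa [h] using (not_le.mp h).le

theorem segment01_child_subset (k κ : ℕ) :
    segment01 (2 ^ (d * (k + 1))) κ ⊆ segment01 (2 ^ (d * k)) (κ / 2 ^ d) := by
  have h1 : κ / 2 ^ d * 2 ^ d ≤ κ := Nat.div_mul_le_self _ _
  have h2 : κ + 1 ≤ (κ / 2 ^ d + 1) * 2 ^ d := by
    have := Nat.lt_div_mul_add (a := κ) (b := 2 ^ d) (by positivity)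
    rw [add_mul, one_mul]; omega
  have h1' : ((κ / 2 ^ d : ℕ) : ℝ) * 2 ^ d ≤ κ := by exact_mod_cast h1
  have h2' : (κ : ℝ) + 1 ≤ (((κ / 2 ^ d : ℕ) : ℝ) + 1) * 2 ^ d := by exact_mod_cast h2
  have hA : (0 : ℝ) < 2 ^ (d * k) := by positivity
  have hB : (0 : ℝ) < 2 ^ d := by positivity
  unfold segment01
  rw [two_pow_mul_succ]
  push_cast only [Nat.cast_mul, Nat.cast_pow, Nat.cast_ofNat]
  apply Icc_subset_Icc
  · rw [div_le_div_iff₀ hA (by positivity)]; nlinarith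
  · rw [div_le_div_iff₀ (by positivity) hA]; nlinarith

theorem hilbertCurve_surjOn {k κ : ℕ} {x : Fin d → ℝ} (hκ : κ < 2 ^ (d * k))
    (hx : x ∈ cubeCell k (hilbertNode d k κ).1) :
    ∃ t ∈ segment01 (2 ^ (d * k)) κ, hilbertCurve d t = x := by
  choose! f hf1 hf2 hf3 using
    fun (m κ : ℕ) (h : κ < 2 ^ (d * m) ∧ x ∈ cubeCell m (hilbertNode d m κ).1) =>
      exists_child_mem h.1 h.2
  let g : ℕ → ℕ := fun m => Nat.rec κ (fun m κ => f (k + m) κ) m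
  have hg0 : g 0 = κ := rfl
  have hgs : ∀ m, g (m + 1) = f (k + m) (g m) := fun m => rfl
  have hg : ∀ m, g m < 2 ^ (d * (k + m)) ∧
      x ∈ cubeCell (k + m) (hilbertNode d (k + m) (g m)).1 := by
    intro m
    induction m with
    | zero => exact ⟨hκ, hx⟩
    | succ m ih => rw [hgs]; exact ⟨hf1 _ _ ih, hf3 _ _ ih⟩
  have hne : (⋂ m, segment01 (2 ^ (d * (k + m))) (g m)).Nonempty := by
    apply IsCompact.nonempty_iInter_of_sequence_nonempty_isCompact_isClosed
    · intro m
      have := segment01_child_subset (d := d) (k + m) (g (m + 1))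
      rwa [hgs, hf2 _ _ (hg m)] at this
    · intro m
      apply nonempty_Icc.mpr
      gcongr; linarith
    · exact isCompact_Icc
    · intro m; exact isClosed_Icc
  obtain ⟨t, ht⟩ := hne
  rw [mem_iInter] at ht
  refine ⟨t, ht 0, eq_of_forall_mem_cubeCell k
    (fun m => (hilbertNode d (k + m) (g m)).1) fun m => ⟨?_, (hg m).2⟩⟩
  exact hilbertCurve_mem_of_mem (hg m).1 (ht m)

theorem hilbertCurve_dist_le {k : ℕ} {s t : ℝ} (hs : 0 ≤ s) (hst : s ≤ t)
    (h : t - s < 1 / 2 ^ (d * k)) (j : Fin d) :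
    |hilbertCurve d s j - hilbertCurve d t j| ≤ 2 * (1 / 2) ^ k := by
  have hM : (0 : ℝ) < 2 ^ (d * k) := by positivity
  have hle : hilbertIndex d k s ≤ hilbertIndex d k t :=
    min_le_min_right _ (Nat.floor_mono (by gcongr))
  have hle' : hilbertIndex d k t ≤ hilbertIndex d k s + 1 := by
    have : ⌊t * 2 ^ (d * k)⌋₊ ≤ ⌊s * 2 ^ (d * k)⌋₊ + 1 := by
      rw [← Nat.floor_add_one (by positivity)]
      apply Nat.floor_mono
      rw [lt_div_iff₀ hM] at h
      linarith
    simp only [hilbertIndex]; omega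
  have h1 := hilbertCurve_mem (d := d) s k
  have h2 := hilbertCurve_mem (d := d) t k
  have hp : (0 : ℝ) < (1 / 2) ^ k := by positivity
  rcases eq_or_lt_of_le hle with he | hlt
  · rw [← he] at h2
    have := abs_sub_le_of_mem_cubeCell h1 h2 j
    linarith
  · have he : hilbertIndex d k t = hilbertIndex d k s + 1 := by omega
    have hb := hilbertIndex_lt (d := d) k t
    rw [he] at h2 hb
    have hm := (hilbertNode_adj (d := d) k _ hb).2
    have h3 := corner_mem_cubeCell (k := k) (hilbertNode d k (hilbertIndex d k s)).1
      (hilbertNode d k (hilbertIndex d k s)).2.exit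
    have h4 := corner_mem_cubeCell (k := k) (hilbertNode d k (hilbertIndex d k s + 1)).1
      (hilbertNode d k (hilbertIndex d k s + 1)).2.entry
    simp only [hm] at h3
    have h5 := abs_sub_le_of_mem_cubeCell h1 h3 j
    have h6 := abs_sub_le_of_mem_cubeCell h4 h2 j
    have := abs_sub_le _ _ _ |>.trans (add_le_add h5 h6)
    linarith

theorem isHilbertCurve_hilbertCurve : IsHilbertCurve d (hilbertCurve d) where
  continuousOn := by
    rw [Metric.continuousOn_iff]
    intro s hs ε hε
    obtain ⟨k, hk⟩ := exists_pow_lt_of_lt_one (half_pos hε) (by norm_num : (1 / 2 : ℝ) < 1)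
    refine ⟨1 / 2 ^ (d * k), by positivity, fun t ht hd => ?_⟩
    rw [Real.dist_eq, abs_lt] at hd
    rw [dist_pi_lt_iff hε]
    intro j
    rw [Real.dist_eq]
    refine lt_of_le_of_lt ?_ (show 2 * (1 / 2 : ℝ) ^ k < ε by linarith)
    rcases le_total t s with h | h
    · exact hilbertCurve_dist_le ht.1 h (by linarith) j
    · rw [abs_sub_comm]
      exact hilbertCurve_dist_le hs.1 h (by linarith) j
  exists_cells k := by
    refine ⟨fun κ => (hilbertNode d k κ).1, hilbertNode_bijOn k, fun κ hκ => ?_,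
      fun κ hκ => (hilbertNode_adj k κ hκ).1⟩
    apply Subset.antisymm
    · rintro _ ⟨t, ht, rfl⟩
      exact hilbertCurve_mem_of_mem hκ ht
    · intro x hx
      obtain ⟨t, ht, rfl⟩ := hilbertCurve_surjOn hκ hx
      exact ⟨t, ht, rfl⟩

end

/-!
The strata `E_i = H([i / N, (i + 1) / N])` inherit two properties of the curve.

* *They are a partition up to null sets into pieces of volume `1 / N`.* The curve does not
  increase volume (`IsHilbertCurve.volume_real_image_le`), since an interval is covered by dyadic
  intervals of nearly the same total length, whose images are cubes of the same volume. As the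
  strata cover the cube, nothing may be lost, and
  `∑ i, vol (E_i ∩ B) = vol B` (`IsHilbertCurve.sum_volume_real_inter`).
* *They are small.* Each lies in two touching dyadic cubes of side at most `2 N ^ (-1 / d)`.

By the second property the strata that meet both a box `B = [0, x]` and its complement lie close to
an upper face of `B`; by the first, there are at most `8 d N ^ (1 - 1 / d)` of them
(`IsHilbertCurve.card_crossing_le_rpow`). In all other strata the indicator of `B` is almost surely
constant, so the number of points in `B` deviates from its mean `N vol B` by a sum of that few
independent centred indicators, and Hoeffding's inequality applies
(`IsHilbertSample.measureReal_deviation_le`).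

It remains to treat all boxes at once. A union bound over the `(N + 1) ^ d` boxes whose upper corner
lies on the grid `(1 / N) ℤᵈ` suffices, because any other box lies between two of these whose
volumes differ from its own by at most `d / N` (`starDiscrepancy_le_of_grid`). The constant `6`
leaves enough room for both errors, and `2 / (1 - q) ≤ exp (c(d, q))` pays for the union bound.
-/

/-! ### Measure and shape of the strata -/

namespace IsHilbertCurve
variable {d : ℕ} [NeZero d] {H : ℝ → Fin d → ℝ}

theorem volume_real_cubeCell (k : ℕ) (c : Fin d → ℕ) :
    volume.real (cubeCell k c) = 1 / 2 ^ (d * k) := by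
  have h : ∀ j : Fin d, ((c j : ℝ) + 1) / 2 ^ k - (c j : ℝ) / 2 ^ k = 1 / 2 ^ k := fun j => by ring
  rw [cubeCell, measureReal_def, Real.volume_Icc_pi_toReal]
  · simp only [h, Finset.prod_const, Finset.card_univ, Fintype.card_fin]
    rw [one_div_pow, ← pow_mul, mul_comm]
  · intro j
    dsimp only
    gcongr; linarith

theorem segment01_subset {N i : ℕ} (hi : i < N) : segment01 N i ⊆ Icc 0 1 := by
  have hN : (0 : ℝ) < N := by exact_mod_cast (Nat.zero_le i).trans_lt hi
  have hi' : (i : ℝ) + 1 ≤ N := by exact_mod_cast hi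
  exact Icc_subset_Icc (by positivity) ((div_le_one hN).mpr hi')

theorem isCompact_hilbertStratum (hH : IsHilbertCurve d H) {N i : ℕ} (hi : i < N) :
    IsCompact (hilbertStratum H N i) :=
  isCompact_Icc.image_of_continuousOn (hH.continuousOn.mono (segment01_subset hi))

theorem measurableSet_hilbertStratum (hH : IsHilbertCurve d H) {N i : ℕ} (hi : i < N) :
    MeasurableSet (hilbertStratum H N i) :=
  (hH.isCompact_hilbertStratum hi).measurableSet

theorem image_unitInterval (hH : IsHilbertCurve d H) : H '' Icc 0 1 = Icc 0 1 := by
  obtain ⟨c, hc, himg, -⟩ := hH.exists_cells 0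
  have h0 := himg 0 (by simp)
  have hc0 : c 0 = 0 := by
    funext j
    have := hc.mapsTo (show (0 : ℕ) ∈ Iio (2 ^ (d * 0)) by simp) j
    simpa using this
  simpa [segment01, cubeCell, hc0, Pi.zero_def, Pi.one_def] using h0

theorem hilbertStratum_subset (hH : IsHilbertCurve d H) {N i : ℕ} (hi : i < N) :
    hilbertStratum H N i ⊆ Icc 0 1 := by
  rw [← hH.image_unitInterval]
  exact image_mono (segment01_subset hi)

theorem iUnion_hilbertStratum (hH : IsHilbertCurve d H) {N : ℕ} (hN : 0 < N) :
    ⋃ i : Fin N, hilbertStratum H N i = Icc 0 1 := by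
  refine Subset.antisymm (iUnion_subset fun i => hH.hilbertStratum_subset i.isLt) ?_
  rw [← hH.image_unitInterval]
  rintro _ ⟨t, ht, rfl⟩
  have hN' : (0 : ℝ) < N := by exact_mod_cast hN
  have h0 : 0 ≤ t * N := mul_nonneg ht.1 hN'.le
  rcases ht.2.eq_or_lt with rfl | h1
  · refine mem_iUnion.mpr ⟨⟨N - 1, by omega⟩, mem_image_of_mem H ⟨?_, ?_⟩⟩ <;>
      rw [Nat.cast_sub (show 1 ≤ N by omega), Nat.cast_one]
    · rw [div_le_one hN']; linarith
    · rw [sub_add_cancel, div_self hN'.ne']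
  · have hlt : ⌊t * N⌋₊ < N := (Nat.floor_lt h0).mpr (by nlinarith)
    refine mem_iUnion.mpr ⟨⟨⌊t * N⌋₊, hlt⟩, mem_image_of_mem H ⟨?_, ?_⟩⟩
    · rw [div_le_iff₀ hN']; exact Nat.floor_le h0
    · rw [le_div_iff₀ hN']; exact (Nat.lt_floor_add_one _).le

theorem hilbertIndex_mono (k : ℕ) : Monotone (hilbertIndex d k) := fun s t h =>
  min_le_min_right _ (Nat.floor_mono (by gcongr))

/-- A Hilbert curve does not increase volume: the interval `[a, b]` meets at most
`(b - a) 2 ^ (d * k) + 2` of the dyadic intervals of order `k`, whose images have volume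
`2 ^ (-d * k)`, and `k` is arbitrary. -/
theorem volume_real_image_le (hH : IsHilbertCurve d H) {a b : ℝ} (ha : 0 ≤ a) (hab : a ≤ b)
    (hb : b ≤ 1) : volume.real (H '' Icc a b) ≤ b - a := by
  have key : ∀ k : ℕ, volume.real (H '' Icc a b) ≤ (b - a) + 2 * (1 / 2) ^ k := by
    intro k
    obtain ⟨c, -, himg, -⟩ := hH.exists_cells k
    have hsub : H '' Icc a b ⊆
        ⋃ κ ∈ Finset.Icc (hilbertIndex d k a) (hilbertIndex d k b), cubeCell k (c κ) := by
      rintro _ ⟨t, ht, rfl⟩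
      refine mem_iUnion₂.mpr ⟨hilbertIndex d k t, Finset.mem_Icc.mpr
        ⟨hilbertIndex_mono k ht.1, hilbertIndex_mono k ht.2⟩, ?_⟩
      rw [← himg _ (hilbertIndex_lt k t)]
      exact mem_image_of_mem H (mem_segment01 ⟨ha.trans ht.1, ht.2.trans hb⟩)
    have hM : (0 : ℝ) < 2 ^ (d * k) := by positivity
    have h1 : volume.real (H '' Icc a b) ≤
        ((hilbertIndex d k b + 1 - hilbertIndex d k a : ℕ) : ℝ) * (1 / 2 ^ (d * k)) := by
      refine (measureReal_mono hsub ?_).trans ((measureReal_biUnion_finset_le _ _).trans ?_)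
      · refine ((measure_biUnion_finset_le _ _).trans_lt ?_).ne
        exact ENNReal.sum_lt_top.mpr fun κ _ => isCompact_Icc.measure_lt_top
      · simp [volume_real_cubeCell]
    have h2 := (mem_segment01 (d := d) (k := k) (t := a) ⟨ha, hab.trans hb⟩).2
    have h3 := (mem_segment01 (d := d) (k := k) (t := b) ⟨ha.trans hab, hb⟩).1
    push_cast at h2 h3
    rw [le_div_iff₀ hM] at h2
    rw [div_le_iff₀ hM] at h3
    have hle : hilbertIndex d k a ≤ hilbertIndex d k b + 1 :=
      (hilbertIndex_mono k hab).trans (Nat.le_succ _)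
    have hpow : (1 : ℝ) / 2 ^ (d * k) ≤ (1 / 2) ^ k := by
      rw [one_div_pow]
      apply one_div_le_one_div_of_le (by positivity)
      exact pow_le_pow_right₀ (by norm_num) (Nat.le_mul_of_pos_left k (Nat.pos_of_neZero d))
    refine h1.trans ?_
    rw [Nat.cast_sub hle]
    push_cast
    calc ((hilbertIndex d k b : ℝ) + 1 - hilbertIndex d k a) * (1 / 2 ^ (d * k))
        ≤ ((b - a) * 2 ^ (d * k) + 2) * (1 / 2 ^ (d * k)) := by gcongr; linarith
      _ = (b - a) + 2 * (1 / 2 ^ (d * k)) := by field_simp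
      _ ≤ _ := by linarith
  have hlim : Filter.Tendsto (fun k : ℕ => (b - a) + 2 * (1 / 2 : ℝ) ^ k) Filter.atTop
      (nhds ((b - a) + 2 * 0)) :=
    ((tendsto_pow_atTop_nhds_zero_of_lt_one (by norm_num) (by norm_num)).const_mul 2).const_add _
  simpa using ge_of_tendsto' hlim key

theorem volume_real_hilbertStratum_le (hH : IsHilbertCurve d H) {N i : ℕ} (hi : i < N) :
    volume.real (hilbertStratum H N i) ≤ 1 / N := by
  have hN : (0 : ℝ) < N := by exact_mod_cast (Nat.zero_le i).trans_lt hi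
  have hi' : (i : ℝ) + 1 ≤ N := by exact_mod_cast hi
  refine (hH.volume_real_image_le (by positivity) (by gcongr; linarith)
    ((div_le_one hN).mpr hi')).trans (le_of_eq ?_)
  ring

theorem volume_real_unitCube : volume.real (Icc (0 : Fin d → ℝ) 1) = 1 := by
  rw [measureReal_def, Real.volume_Icc_pi_toReal zero_le_one]; simp

/-- The strata cut a measurable set `B` into pieces whose volumes add up to that of `B` in the
unit cube. They cover the cube, so that "at least" holds for `B` and for its complement; since the
total volume of the strata is at most `1`, both are equalities. -/
theorem sum_volume_real_inter (hH : IsHilbertCurve d H) {N : ℕ} (hN : 0 < N)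
    {B : Set (Fin d → ℝ)} (hB : MeasurableSet B) :
    ∑ i : Fin N, volume.real (hilbertStratum H N i ∩ B) = volume.real (Icc 0 1 ∩ B) := by
  have hle : ∀ C : Set (Fin d → ℝ),
      volume.real (Icc 0 1 ∩ C) ≤ ∑ i : Fin N, volume.real (hilbertStratum H N i ∩ C) := by
    intro C
    rw [← hH.iUnion_hilbertStratum hN, iUnion_inter]
    exact measureReal_iUnion_fintype_le _
  have hfin : ∀ i : Fin N, volume (hilbertStratum H N i) ≠ ⊤ := fun i =>
    (hH.isCompact_hilbertStratum i.isLt).measure_lt_top.ne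
  have hQ := measureReal_inter_add_sdiff (μ := volume) (s := Icc (0 : Fin d → ℝ) 1) hB
    isCompact_Icc.measure_lt_top.ne
  have hE : ∑ i : Fin N, volume.real (hilbertStratum H N i ∩ B) +
      ∑ i : Fin N, volume.real (hilbertStratum H N i ∩ Bᶜ) ≤ 1 := by
    rw [← Finset.sum_add_distrib]
    have hN' : (N : ℝ) ≠ 0 := by exact_mod_cast hN.ne'
    calc _ = ∑ i : Fin N, volume.real (hilbertStratum H N i) :=
          Finset.sum_congr rfl fun i _ => measureReal_inter_add_sdiff hB (hfin i)
      _ ≤ ∑ i : Fin N, 1 / (N : ℝ) :=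
          Finset.sum_le_sum fun i _ => hH.volume_real_hilbertStratum_le i.isLt
      _ = 1 := by simp [hN']
  rw [volume_real_unitCube, sdiff_eq] at hQ
  have := hle B
  have := hle Bᶜ
  linarith

theorem volume_real_hilbertStratum (hH : IsHilbertCurve d H) {N : ℕ} (i : Fin N) :
    volume.real (hilbertStratum H N i) = 1 / N := by
  have hN : 0 < N := i.pos
  have hN' : (N : ℝ) ≠ 0 := by exact_mod_cast hN.ne'
  have hsum := hH.sum_volume_real_inter hN MeasurableSet.univ
  simp only [inter_univ, volume_real_unitCube] at hsum
  refine (Finset.sum_eq_sum_iff_of_le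
    (fun j _ => hH.volume_real_hilbertStratum_le (i := (j : Fin N)) j.isLt)).mp ?_ i
    (Finset.mem_univ i)
  rw [hsum]; simp [hN']

/-- An interval of length at most `2 ^ (-d * k)` lies in two consecutive dyadic intervals of order
`k`, and the two cubes they are mapped onto have a point in common. -/
theorem abs_sub_le_of_mem_image (hH : IsHilbertCurve d H) {k : ℕ} {s t : ℝ} (hs : 0 ≤ s)
    (hst : s ≤ t) (ht : t ≤ 1) (h : t - s ≤ 1 / 2 ^ (d * k)) (j : Fin d) :
    |H s j - H t j| ≤ 2 * (1 / 2) ^ k := by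
  obtain ⟨c, -, himg, -⟩ := hH.exists_cells k
  have hM : (0 : ℝ) < 2 ^ (d * k) := by positivity
  have hmem : ∀ κ < 2 ^ (d * k), ∀ u ∈ segment01 (2 ^ (d * k)) κ, H u ∈ cubeCell k (c κ) :=
    fun κ hκ u hu => himg κ hκ ▸ mem_image_of_mem H hu
  have hsS := mem_segment01 (d := d) (k := k) ⟨hs, hst.trans ht⟩
  have htS := mem_segment01 (d := d) (k := k) ⟨hs.trans hst, ht⟩
  set κ := hilbertIndex d k s
  have hκ : κ < 2 ^ (d * k) := hilbertIndex_lt k s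
  have h1 := hmem _ hκ _ hsS
  have hp : (0 : ℝ) < (1 / 2) ^ k := by positivity
  by_cases hle : t ≤ ((κ : ℝ) + 1) / 2 ^ (d * k)
  · have h2 := hmem κ hκ t ⟨hsS.1.trans hst, by push_cast; exact hle⟩
    have := abs_sub_le_of_mem_cubeCell h1 h2 j
    linarith
  · push Not at hle
    have hκ' : κ + 1 < 2 ^ (d * k) := by
      have h3 := hle.trans_le ht
      rw [div_lt_one hM] at h3
      exact_mod_cast h3
    have h2 := hsS.2
    push_cast at h2
    have h3 := hmem (κ + 1) hκ' t ⟨by push_cast; exact hle.le, by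
      push_cast
      rw [add_div]
      linarith⟩
    -- The common endpoint of the two dyadic intervals.
    have h4 := hmem κ hκ (((κ : ℝ) + 1) / 2 ^ (d * k)) ⟨by push_cast; gcongr; linarith, by simp⟩
    have h5 := hmem (κ + 1) hκ' (((κ : ℝ) + 1) / 2 ^ (d * k))
      ⟨by simp, by push_cast; gcongr; linarith⟩
    have h6 := abs_sub_le_of_mem_cubeCell h1 h4 j
    have h7 := abs_sub_le_of_mem_cubeCell h5 h3 j
    have := (abs_sub_le _ _ _).trans (add_le_add h6 h7)
    linarith

theorem abs_sub_le_of_mem_hilbertStratum (hH : IsHilbertCurve d H) {k N i : ℕ} (hi : i < N)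
    (hk : 2 ^ (d * k) ≤ N) {y z : Fin d → ℝ} (hy : y ∈ hilbertStratum H N i)
    (hz : z ∈ hilbertStratum H N i) (j : Fin d) : |y j - z j| ≤ 2 * (1 / 2) ^ k := by
  obtain ⟨s, hs, rfl⟩ := hy
  obtain ⟨t, ht, rfl⟩ := hz
  have hk' : 1 / (N : ℝ) ≤ 1 / 2 ^ (d * k) :=
    one_div_le_one_div_of_le (by positivity) (by exact_mod_cast hk)
  have hs' := segment01_subset hi hs
  have ht' := segment01_subset hi ht
  have h1 := hs.1
  have h2 := hs.2
  have h3 := ht.1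
  have h4 := ht.2
  rw [add_div] at h2 h4
  rcases le_total s t with h | h
  · exact hH.abs_sub_le_of_mem_image hs'.1 h ht'.2 (by linarith) j
  · rw [abs_sub_comm]
    exact hH.abs_sub_le_of_mem_image ht'.1 h hs'.2 (by linarith) j

theorem volume_real_slab_le (j : Fin d) (a : ℝ) {w : ℝ} (hw : 0 ≤ w) :
    volume.real (Icc (0 : Fin d → ℝ) 1 ∩ {u | |u j - a| ≤ w}) ≤ 2 * w := by
  classical
  have hsub : Icc (0 : Fin d → ℝ) 1 ∩ {u | |u j - a| ≤ w} ⊆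
      Icc (Function.update 0 j (a - w)) (Function.update 1 j (a + w)) := by
    rintro u ⟨⟨h0, h1⟩, h2⟩
    rw [mem_ofPred_eq, abs_le] at h2
    exact ⟨update_le_iff.mpr ⟨by linarith [h2.1], fun i _ => h0 i⟩,
      le_update_iff.mpr ⟨by linarith [h2.2], fun i _ => h1 i⟩⟩
  refine (measureReal_mono hsub isCompact_Icc.measure_lt_top.ne).trans (le_of_eq ?_)
  have hle : Function.update (0 : Fin d → ℝ) j (a - w) ≤ Function.update (1 : Fin d → ℝ) j (a + w) :=
    update_le_update_iff.mpr ⟨by linarith, fun i _ => by simp⟩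
  rw [measureReal_def, Real.volume_Icc_pi_toReal hle, Finset.prod_eq_single j]
  · simp; ring
  · intro i _ hi; simp [hi]
  · simp

open Classical in
/-- The indices of the strata that meet both `B` and its complement. -/
noncomputable def crossing (H : ℝ → Fin d → ℝ) (N : ℕ) (B : Set (Fin d → ℝ)) : Finset (Fin N) :=
  {i | (hilbertStratum H N i ∩ B).Nonempty ∧ ¬ hilbertStratum H N i ⊆ B}

/-- The strata that cross the boundary of a box lie close to one of its upper faces, hence in a
set of small volume. -/
theorem card_crossing_le (hH : IsHilbertCurve d H) {k N : ℕ} (hk : 2 ^ (d * k) ≤ N)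
    (x : Fin d → ℝ) : ((crossing H N (Icc 0 x)).card : ℝ) ≤ 4 * d * (1 / 2) ^ k * N := by
  have hN : 0 < N := (by positivity : 0 < 2 ^ (d * k)).trans_le hk
  have hN' : (0 : ℝ) < N := by exact_mod_cast hN
  set w : ℝ := 2 * (1 / 2) ^ k with hw
  have hw0 : 0 ≤ w := by positivity
  let T : Set (Fin d → ℝ) := ⋃ j : Fin d, {u | |u j - x j| ≤ w}
  have hT : MeasurableSet T := MeasurableSet.iUnion fun j =>
    (isClosed_le (by fun_prop) continuous_const).measurableSet
  have hsub : ∀ i ∈ crossing H N (Icc 0 x), hilbertStratum H N i ⊆ T := by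
    intro i hi u hu
    simp only [crossing, Finset.mem_filter, Finset.mem_univ, true_and, not_subset] at hi
    obtain ⟨⟨y, hy, hyx⟩, z, hz, hzx⟩ := hi
    have hz0 := (hH.hilbertStratum_subset i.isLt hz).1
    obtain ⟨j, hj⟩ : ∃ j, x j < z j := by
      by_contra! hcon
      exact hzx ⟨hz0, hcon⟩
    have hyj : y j ≤ x j := hyx.2 j
    have h1 := abs_le.mp (hH.abs_sub_le_of_mem_hilbertStratum i.isLt hk hu hy j)
    have h2 := abs_le.mp (hH.abs_sub_le_of_mem_hilbertStratum i.isLt hk hu hz j)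
    have hux : |u j - x j| ≤ w := abs_le.mpr ⟨by linarith [h2.1], by linarith [h1.2]⟩
    exact mem_iUnion.mpr ⟨j, hux⟩
  have h1 : ((crossing H N (Icc 0 x)).card : ℝ) * (1 / N) ≤ volume.real (Icc 0 1 ∩ T) := by
    rw [← hH.sum_volume_real_inter hN hT, ← nsmul_eq_mul, ← Finset.sum_const]
    refine (Finset.sum_le_sum fun i hi => ?_).trans
      (Finset.sum_le_univ_sum_of_nonneg fun i => measureReal_nonneg)
    rw [inter_eq_self_of_subset_left (hsub i hi), hH.volume_real_hilbertStratum]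
  have h2 : volume.real (Icc 0 1 ∩ T) ≤ d * (2 * w) := by
    rw [inter_iUnion]
    refine (measureReal_iUnion_fintype_le _).trans
      ((Finset.sum_le_sum fun j _ => volume_real_slab_le j (x j) hw0).trans ?_)
    simp
  have h3 := h1.trans h2
  rw [mul_one_div, div_le_iff₀ hN'] at h3
  refine h3.trans (le_of_eq ?_)
  rw [hw]; ring

/-- With `k` the largest order for which `2 ^ (d * k) ≤ N`, the cubes of order `k` have side at
most `2 N ^ (-1 / d)`. -/
theorem card_crossing_le_rpow (hH : IsHilbertCurve d H) {N : ℕ} (hN : 0 < N)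
    (x : Fin d → ℝ) :
    ((crossing H N (Icc 0 x)).card : ℝ) ≤ 8 * d * (N : ℝ) ^ (1 - 1 / d : ℝ) := by
  have hd : 0 < d := Nat.pos_of_neZero d
  have hN' : (0 : ℝ) < N := by exact_mod_cast hN
  set k := Nat.log (2 ^ d) N
  have h1 : 2 ^ (d * k) ≤ N := by
    rw [pow_mul]; exact Nat.pow_log_le_self _ hN.ne'
  have h2 : N < 2 ^ (d * (k + 1)) := by
    rw [pow_mul]
    exact Nat.lt_pow_succ_log_self (Nat.one_lt_two_pow hd.ne') N
  have h3 : (N : ℝ) ^ (1 / d : ℝ) ≤ 2 ^ (k + 1) := by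
    rw [one_div, Real.rpow_inv_le_iff_of_pos hN'.le (by positivity) (by exact_mod_cast hd),
      Real.rpow_natCast, ← pow_mul, mul_comm]
    exact_mod_cast h2.le
  have h4 : (1 / 2 : ℝ) ^ k ≤ 2 * (N : ℝ) ^ (-(1 / d) : ℝ) := by
    have h5 : (0 : ℝ) < (N : ℝ) ^ (1 / d : ℝ) := by positivity
    rw [Real.rpow_neg hN'.le, one_div_pow, ← div_eq_mul_inv, div_le_div_iff₀ (by positivity) h5,
      one_mul, ← pow_succ']
    exact h3
  calc ((crossing H N (Icc 0 x)).card : ℝ) ≤ 4 * d * (1 / 2) ^ k * N := hH.card_crossing_le h1 x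
    _ ≤ 4 * d * (2 * (N : ℝ) ^ (-(1 / d) : ℝ)) * N := by gcongr
    _ = 8 * d * (N : ℝ) ^ (1 - 1 / d : ℝ) := by
      rw [sub_eq_neg_add, Real.rpow_add hN', Real.rpow_one]; ring

end IsHilbertCurve

/-! ### Concentration of the counting function of one box -/

/-- The number of points of the family `P` that lie in the box `[0, x]`. -/
noncomputable def boxCount {d N : ℕ} (P : Fin N → Fin d → ℝ) (x : Fin d → ℝ) : ℝ :=
  ∑ n, (Icc 0 x).indicator (fun _ => (1 : ℝ)) (P n)

namespace IsHilbertSample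
variable {d N : ℕ} [NeZero d] {H : ℝ → Fin d → ℝ} {Ω : Type*} [MeasurableSpace Ω] {μ : Measure Ω}
  {X : Fin N → Ω → Fin d → ℝ}

theorem measureReal_preimage (hX : IsHilbertSample H μ X) (hH : IsHilbertCurve d H) (i : Fin N)
    {B : Set (Fin d → ℝ)} (hB : MeasurableSet B) :
    μ.real (X i ⁻¹' B) = N * volume.real (hilbertStratum H N i ∩ B) := by
  have hN : (0 : ℝ) < N := by exact_mod_cast i.pos
  have hv := hH.volume_real_hilbertStratum i
  have hne : volume (hilbertStratum H N i) ≠ 0 := by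
    intro h0
    rw [measureReal_def, h0, ENNReal.toReal_zero] at hv
    exact (one_div_pos.mpr hN).ne hv
  rw [measureReal_def, (hX.uniform i).measure_preimage hne
    (hH.isCompact_hilbertStratum i.isLt).measure_lt_top.ne hB, ENNReal.toReal_div,
    ← measureReal_def, ← measureReal_def, hv]
  field_simp

variable [IsProbabilityMeasure μ]

theorem ae_mem (hX : IsHilbertSample H μ X) (hH : IsHilbertCurve d H) :
    ∀ᵐ ω ∂μ, ∀ i : Fin N, X i ω ∈ hilbertStratum H N i := by
  rw [ae_all_iff]
  intro i
  have hN : (N : ℝ) ≠ 0 := by exact_mod_cast i.pos.ne'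
  have hm := hH.measurableSet_hilbertStratum i.isLt
  have h1 : μ.real (X i ⁻¹' hilbertStratum H N i) = 1 := by
    rw [hX.measureReal_preimage hH i hm, inter_self, hH.volume_real_hilbertStratum]
    field_simp
  have h2 : μ (X i ⁻¹' hilbertStratum H N i) = 1 := by
    rw [← ofReal_measureReal, h1, ENNReal.ofReal_one]
  exact (mem_ae_iff_prob_eq_one (hX.measurable i hm)).mpr h2

/-- The centred indicator that the `i`-th point lies in `B`. -/
noncomputable def centredIndicator (H : ℝ → Fin d → ℝ) (N : ℕ) (B : Set (Fin d → ℝ)) (i : Fin N)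
    (u : Fin d → ℝ) : ℝ :=
  B.indicator (fun _ => (1 : ℝ)) u - N * volume.real (hilbertStratum H N i ∩ B)

theorem measurable_centredIndicator {B : Set (Fin d → ℝ)} (hB : MeasurableSet B) (i : Fin N) :
    Measurable (centredIndicator H N B i) :=
  (measurable_const.indicator hB).sub_const _

theorem centredIndicator_eq_zero (hH : IsHilbertCurve d H) {B : Set (Fin d → ℝ)} {i : Fin N}
    (hi : i ∉ IsHilbertCurve.crossing H N B) {u : Fin d → ℝ} (hu : u ∈ hilbertStratum H N i) :
    centredIndicator H N B i u = 0 := by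
  have hN : (N : ℝ) ≠ 0 := by exact_mod_cast i.pos.ne'
  simp only [IsHilbertCurve.crossing, Finset.mem_filter, Finset.mem_univ, true_and, not_and,
    not_not] at hi
  unfold centredIndicator
  by_cases hne : (hilbertStratum H N i ∩ B).Nonempty
  · rw [inter_eq_self_of_subset_left (hi hne), hH.volume_real_hilbertStratum,
      indicator_of_mem (hi hne hu)]
    field_simp; simp
  · have huB : u ∉ B := fun h => hne ⟨u, hu, h⟩
    rw [not_nonempty_iff_eq_empty.mp hne, indicator_of_notMem huB]
    simp

theorem hasSubgaussianMGF_centredIndicator (hX : IsHilbertSample H μ X)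
    (hH : IsHilbertCurve d H) {B : Set (Fin d → ℝ)} (hB : MeasurableSet B) (i : Fin N) :
    HasSubgaussianMGF (fun ω => centredIndicator H N B i (X i ω)) (1 / 4) μ := by
  have hm : Measurable fun ω => B.indicator (fun _ => (1 : ℝ)) (X i ω) :=
    (measurable_const.indicator hB).comp (hX.measurable i)
  have h := hasSubgaussianMGF_of_mem_Icc (μ := μ) (a := 0) (b := 1) hm.aemeasurable
    (ae_of_all _ fun ω => ⟨indicator_nonneg (by simp) _, indicator_le_self' (by simp) _⟩)
  have hint : ∫ ω, B.indicator (fun _ => (1 : ℝ)) (X i ω) ∂μ =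
      N * volume.real (hilbertStratum H N i ∩ B) := by
    rw [← hX.measureReal_preimage hH i hB, ← integral_indicator_one (hX.measurable i hB)]
    rfl
  have hvar : ((‖(1 : ℝ) - 0‖₊ / 2) ^ 2 : NNReal) = 1 / 4 := by
    rw [sub_zero, nnnorm_one]; norm_num
  rwa [hint, hvar] at h

/-- Hoeffding's inequality for the number of points in a box. Only the strata that cross the
boundary of the box contribute to its deviation from the mean. -/
theorem measureReal_deviation_le (hX : IsHilbertSample H μ X) (hH : IsHilbertCurve d H)
    (hN : 0 < N) {x : Fin d → ℝ} (hx : x ≤ 1) {t K : ℝ} (ht : 0 < t)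
    (hK : ((IsHilbertCurve.crossing H N (Icc 0 x)).card : ℝ) ≤ K) :
    μ.real {ω | t ≤ |N * volume.real (Icc 0 x) - boxCount (fun i => X i ω) x|} ≤
      2 * Real.exp (-(2 * t ^ 2 / K)) := by
  set B : Set (Fin d → ℝ) := Icc 0 x
  have hB : MeasurableSet B := measurableSet_Icc
  set s := IsHilbertCurve.crossing H N B
  let Z : Fin N → Ω → ℝ := fun i ω => centredIndicator H N B i (X i ω)
  have hZ : ∀ i, HasSubgaussianMGF (Z i) (1 / 4) μ :=
    hX.hasSubgaussianMGF_centredIndicator hH hB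
  have hind : iIndepFun Z μ := hX.indep.comp _ fun i => measurable_centredIndicator hB i
  have hind' : iIndepFun (fun i => -Z i) μ :=
    hX.indep.comp (fun i u => -centredIndicator H N B i u) fun i =>
      (measurable_centredIndicator hB i).neg
  have hbound : ∀ W : Fin N → Ω → ℝ, iIndepFun W μ → (∀ i, HasSubgaussianMGF (W i) (1 / 4) μ) →
      μ.real {ω | t ≤ ∑ i ∈ s, W i ω} ≤ Real.exp (-(2 * t ^ 2 / K)) := by
    intro W hW hWs
    rcases s.eq_empty_or_nonempty with h0 | h0
    -- Here the Gaussian bound would read `exp (-t ^ 2 / 0) = 1`, but the event is empty.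
    · have : {ω | t ≤ ∑ i ∈ s, W i ω} = ∅ := by
        rw [h0]; ext ω; simpa using ht
      rw [this, measureReal_empty]
      positivity
    · have hs : (0 : ℝ) < s.card := by exact_mod_cast h0.card_pos
      refine (HasSubgaussianMGF.measure_sum_ge_le_of_iIndepFun hW (fun i _ => hWs i) ht.le).trans ?_
      apply Real.exp_le_exp.mpr
      have h1 : -t ^ 2 / (2 * ((∑ i ∈ s, (1 / 4 : NNReal) : NNReal) : ℝ)) =
          -(2 * t ^ 2 / s.card) := by
        simp only [Finset.sum_const, nsmul_eq_mul]
        push_cast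
        field_simp
        norm_num
      rw [h1]
      gcongr
  have hsum : ∀ᵐ ω ∂μ, boxCount (fun i => X i ω) x - N * volume.real B = ∑ i ∈ s, Z i ω := by
    filter_upwards [hX.ae_mem hH] with ω hω
    have h1 : ∑ i : Fin N, volume.real (hilbertStratum H N i ∩ B) = volume.real B := by
      rw [hH.sum_volume_real_inter hN hB,
        inter_eq_self_of_subset_right (Icc_subset_Icc_right hx)]
    rw [← h1, Finset.mul_sum, boxCount, ← Finset.sum_sub_distrib]
    refine (Finset.sum_subset (Finset.subset_univ s) fun i _ hi => ?_).symm
    exact centredIndicator_eq_zero hH hi (hω i)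
  have hle : {ω | t ≤ |N * volume.real B - boxCount (fun i => X i ω) x|} ≤ᵐ[μ]
      ({ω | t ≤ ∑ i ∈ s, Z i ω} ∪ {ω | t ≤ ∑ i ∈ s, (-Z i) ω} : Set Ω) := by
    filter_upwards [hsum] with ω hω h
    have h' : t ≤ |∑ i ∈ s, Z i ω| := by rw [← hω, abs_sub_comm]; exact h
    rcases le_abs.mp h' with h' | h'
    · exact Or.inl h'
    · right
      show t ≤ ∑ i ∈ s, (-Z i) ω
      simpa using h'
  calc _ ≤ μ.real ({ω | t ≤ ∑ i ∈ s, Z i ω} ∪ {ω | t ≤ ∑ i ∈ s, (-Z i) ω}) :=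
        ENNReal.toReal_mono (measure_ne_top _ _) (measure_mono_ae hle)
    _ ≤ _ := measureReal_union_le _ _
    _ ≤ _ := by
      rw [two_mul]
      exact add_le_add (hbound Z hind hZ) (hbound _ hind' fun i => (hZ i).neg)

end IsHilbertSample

/-! ### Reduction to finitely many boxes -/

theorem Finset.prod_sub_prod_le_sum_sub {ι : Type*} (s : Finset ι) {u v : ι → ℝ}
    (hv : ∀ i ∈ s, 0 ≤ v i) (hvu : ∀ i ∈ s, v i ≤ u i) (hu : ∀ i ∈ s, u i ≤ 1) :
    ∏ i ∈ s, u i - ∏ i ∈ s, v i ≤ ∑ i ∈ s, (u i - v i) := by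
  classical
  induction s using Finset.induction_on with
  | empty => simp
  | insert a s ha ih =>
    rw [Finset.forall_mem_insert] at hv hvu hu
    have h1 := ih hv.2 hvu.2 hu.2
    have h2 : ∏ i ∈ s, v i ≤ 1 :=
      Finset.prod_le_one hv.2 fun i hi => (hvu.2 i hi).trans (hu.2 i hi)
    have h3 : ∏ i ∈ s, v i ≤ ∏ i ∈ s, u i := Finset.prod_le_prod hv.2 hvu.2
    rw [Finset.prod_insert ha, Finset.prod_insert ha, Finset.sum_insert ha]
    nlinarith [hv.1, hvu.1, hu.1]

theorem volume_real_Icc_zero {d : ℕ} {x : Fin d → ℝ} (hx : 0 ≤ x) :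
    volume.real (Icc 0 x) = ∏ j, x j := by
  rw [measureReal_def, Real.volume_Icc_pi_toReal hx]; simp

theorem boxCount_mono {d N : ℕ} (P : Fin N → Fin d → ℝ) : Monotone (boxCount P) := fun _ _ h =>
  Finset.sum_le_sum fun _ _ => indicator_le_indicator_of_subset (Icc_subset_Icc_right h)
    (fun _ => zero_le_one) _

/-- The star discrepancy is controlled by the boxes `[0, g / N]` with integral `g`: every box lies
between two of them whose coordinates differ by at most `1 / N`. -/
theorem starDiscrepancy_le_of_grid {d N : ℕ} (hN : 0 < N) (P : Fin N → Fin d → ℝ) {δ : ℝ}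
    (h : ∀ g : Fin d → Fin (N + 1),
      |volume.real (Icc (0 : Fin d → ℝ) fun j => ((g j : ℕ) : ℝ) / N) -
        boxCount P (fun j => ((g j : ℕ) : ℝ) / N) / N| ≤ δ) :
    starDiscrepancy P ≤ δ + d / N := by
  have hN' : (0 : ℝ) < N := by exact_mod_cast hN
  have : Nonempty (Icc (0 : Fin d → ℝ) 1) := ⟨⟨0, le_rfl, zero_le_one⟩⟩
  refine ciSup_le fun ⟨x, hx0, hx1⟩ => ?_
  have h0 : ∀ j, 0 ≤ x j * N := fun j => mul_nonneg (hx0 j) hN'.le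
  have h1 : ∀ j, x j * N ≤ N := fun j => by have := hx1 j; simp only [Pi.one_apply] at this; nlinarith
  let lo : Fin d → ℝ := fun j => (⌊x j * N⌋₊ : ℝ) / N
  let hi : Fin d → ℝ := fun j => (⌈x j * N⌉₊ : ℝ) / N
  have hlo0 : 0 ≤ lo := fun j => by simp only [lo, Pi.zero_apply]; positivity
  have hlox : lo ≤ x := fun j => (div_le_iff₀ hN').mpr (Nat.floor_le (h0 j))
  have hxhi : x ≤ hi := fun j => (le_div_iff₀ hN').mpr (Nat.le_ceil _)
  have hceil : ∀ j, ⌈x j * N⌉₊ ≤ N := fun j => Nat.ceil_le.mpr (h1 j)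
  have hhi1 : hi ≤ 1 := fun j => (div_le_one hN').mpr (by exact_mod_cast hceil j)
  have hgap : ∀ u v : Fin d → ℝ, 0 ≤ v → v ≤ u → u ≤ 1 → (∀ j, u j - v j ≤ 1 / N) →
      volume.real (Icc 0 u) - volume.real (Icc 0 v) ≤ d / N := by
    intro u v hv hvu hu huv
    rw [volume_real_Icc_zero hv, volume_real_Icc_zero (hv.trans hvu)]
    refine (Finset.prod_sub_prod_le_sum_sub _ (fun j _ => hv j) (fun j _ => hvu j)
      fun j _ => hu j).trans ((Finset.sum_le_sum fun j _ => huv j).trans (le_of_eq ?_))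
    simp [div_eq_mul_inv]
  have g1 := hgap x lo hlo0 hlox hx1 fun j => by
    have := (Nat.lt_floor_add_one (x j * N)).le
    rw [← div_le_div_iff_of_pos_right hN', mul_div_cancel_right₀ _ hN'.ne', add_div] at this
    simp only [lo]; linarith
  have g2 := hgap hi x hx0 hxhi hhi1 fun j => by
    have := (Nat.ceil_lt_add_one (h0 j)).le
    rw [← div_le_div_iff_of_pos_right hN', add_div, mul_div_cancel_right₀ _ hN'.ne'] at this
    simp only [hi]; linarith
  have h2 := abs_le.mp (h fun j => ⟨⌊x j * N⌋₊, Nat.lt_succ_of_le ((Nat.floor_le_ceil _).trans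
    (hceil j))⟩)
  have h3 := abs_le.mp (h fun j => ⟨⌈x j * N⌉₊, Nat.lt_succ_of_le (hceil j)⟩)
  have h4 : boxCount P lo / N ≤ boxCount P x / N := by gcongr; exact boxCount_mono P hlox
  have h5 : boxCount P x / N ≤ boxCount P hi / N := by gcongr; exact boxCount_mono P hxhi
  change |volume.real (Icc 0 x) - boxCount P x / N| ≤ _
  simp only [lo, hi] at g1 g2 h4 h5
  rw [abs_le]
  constructor <;> linarith [h2.1, h2.2, h3.1, h3.2]

/-! ### The constants -/

theorem exp_discConst {d : ℕ} (hd : 1 ≤ d) {q : ℝ} (hq : q < 1) :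
    Real.exp (discConst d q) = (2 * Real.exp 1) ^ d / (√(2 * Real.pi * d) * (1 - q)) := by
  have hd' : (0 : ℝ) < d := by exact_mod_cast hd
  have hq' : 0 < 1 - q := by linarith
  exact Real.exp_log (by positivity)

theorem two_div_le_exp_discConst {d : ℕ} (hd : 1 ≤ d) {q : ℝ} (hq : q < 1) :
    2 / (1 - q) ≤ Real.exp (discConst d q) := by
  have hd' : (0 : ℝ) < d := by exact_mod_cast hd
  have hq' : 0 < 1 - q := by linarith
  have hs : 2 * √(2 * Real.pi * d) ≤ (2 * Real.exp 1) ^ d := by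
    refine le_of_sq_le_sq ?_ (by positivity)
    have h1 : (29 : ℝ) ≤ (2 * Real.exp 1) ^ 2 := by nlinarith [Real.exp_one_gt_d9]
    have h2 : 1 + (d : ℝ) * 28 ≤ (1 + 28) ^ d := one_add_mul_le_pow (by norm_num) d
    calc (2 * √(2 * Real.pi * d)) ^ 2 = 8 * Real.pi * d := by
          rw [mul_pow, Real.sq_sqrt (by positivity)]; ring
      _ ≤ 1 + (d : ℝ) * 28 := by nlinarith [Real.pi_lt_d2]
      _ ≤ 29 ^ d := by norm_num at h2 ⊢; exact h2
      _ ≤ ((2 * Real.exp 1) ^ 2) ^ d := by gcongr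
      _ = ((2 * Real.exp 1) ^ d) ^ 2 := by rw [← pow_mul, ← pow_mul, mul_comm 2 d]
  rw [exp_discConst hd hq, div_le_div_iff₀ hq' (by positivity), ← mul_assoc]
  gcongr

theorem log_two_le_discConst {d : ℕ} (hd : 1 ≤ d) {q : ℝ} (hq0 : 0 ≤ q) (hq : q < 1) :
    Real.log 2 ≤ discConst d q := by
  rw [Real.log_le_iff_le_exp two_pos]
  refine le_trans ?_ (two_div_le_exp_discConst hd hq)
  rw [le_div_iff₀ (by linarith)]; linarith

namespace IsHilbertSample

/-- The probability estimate for an arbitrary number `N` of strata. With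
`A = d ln (N + 1) + c(d, q)` and `r = d^{3/4} N^{-1/2-1/(2d)} √A`, the boxes of the grid
`(1/N) ℤᵈ` are all treated up to an error `4 r`, and passing to arbitrary boxes costs
`d / N ≤ 2 r`. -/
theorem ofReal_le_measure_starDiscrepancy_le {d N : ℕ} [NeZero d] {H : ℝ → Fin d → ℝ}
    {Ω : Type*} [MeasurableSpace Ω] {μ : Measure Ω} [IsProbabilityMeasure μ]
    {X : Fin N → Ω → Fin d → ℝ} (hX : IsHilbertSample H μ X) (hH : IsHilbertCurve d H)
    (hN : 0 < N) {q : ℝ} (hq0 : 0 ≤ q) (hq1 : q < 1) :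
    ENNReal.ofReal q ≤ μ {ω | starDiscrepancy (fun i => X i ω) ≤ discBound d q N} := by
  have hd : 1 ≤ d := Nat.pos_of_neZero d
  have hd' : (1 : ℝ) ≤ d := by exact_mod_cast hd
  have hd0 : (0 : ℝ) < d := by linarith
  have hN1 : (1 : ℝ) ≤ N := by exact_mod_cast hN
  have hN0 : (0 : ℝ) < N := by linarith
  have hq' : 0 < 1 - q := by linarith
  have hc := log_two_le_discConst hd hq0 hq1
  have hlog2 : (1 / 2 : ℝ) ≤ Real.log 2 := by linarith [Real.log_two_gt_d9]
  set c := discConst d q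
  have hc0 : 0 ≤ c := by linarith
  set A : ℝ := d * Real.log (N + 1) + c with hA
  have hlogN : 1 / 2 ≤ Real.log (N + 1) :=
    hlog2.trans (Real.log_le_log two_pos (by linarith))
  have hAd : (d : ℝ) / 4 ≤ A := by nlinarith
  have hA0 : 0 < A := by linarith
  set a : ℝ := 1 / 2 + 1 / (2 * d) with ha
  have ha1 : a ≤ 1 := by
    have : 1 / (2 * (d : ℝ)) ≤ 1 / 2 := one_div_le_one_div_of_le two_pos (by linarith)
    linarith
  set r : ℝ := (d : ℝ) ^ (3 / 4 : ℝ) / (N : ℝ) ^ a * √A with hr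
  have hr0 : 0 < r := by positivity
  have hd34 : ((d : ℝ) ^ (3 / 4 : ℝ)) ^ 2 = d * √d := by
    rw [← Real.rpow_natCast, ← Real.rpow_mul hd0.le, Real.sqrt_eq_rpow]
    nth_rewrite 2 [← Real.rpow_one (d : ℝ)]
    rw [← Real.rpow_add hd0]; norm_num
  have hd34' : (d : ℝ) ≤ ((d : ℝ) ^ (3 / 4 : ℝ)) ^ 2 := by
    rw [hd34]
    exact le_mul_of_one_le_right hd0.le (Real.one_le_sqrt.mpr hd')
  have hbound : 6 * r ≤ discBound d q N := by
    have h1 : 0 ≤ 2 * c / (3 * N) := by positivity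
    have h2 : discBound d q N = 6 * r + 2 * c / (3 * N) := by
      rw [hr, discBound, ← hA, ← ha]; ring
    linarith
  have hgrid : (d : ℝ) / N ≤ 2 * r := by
    have h1 : (N : ℝ) ^ a ≤ N := by
      simpa using Real.rpow_le_rpow_of_exponent_le hN1 ha1
    have h2 : (d : ℝ) ≤ 2 * ((d : ℝ) ^ (3 / 4 : ℝ) * √A) := by
      refine le_of_sq_le_sq ?_ (by positivity)
      rw [mul_pow, mul_pow, Real.sq_sqrt hA0.le]
      nlinarith
    calc (d : ℝ) / N ≤ 2 * ((d : ℝ) ^ (3 / 4 : ℝ) * √A) / (N : ℝ) ^ a := by gcongr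
      _ = 2 * r := by rw [hr]; ring
  set K : ℝ := 8 * d * (N : ℝ) ^ (1 - 1 / d : ℝ) with hK
  have hK0 : 0 < K := by positivity
  have hexponent : A ≤ 2 * (N * (4 * r)) ^ 2 / K := by
    have hNa : (N : ℝ) ^ 2 = (N : ℝ) ^ (1 - 1 / d : ℝ) * ((N : ℝ) ^ a) ^ 2 := by
      rw [← Real.rpow_natCast ((N : ℝ) ^ a), ← Real.rpow_mul hN0.le, ← Real.rpow_add hN0,
        ← Real.rpow_natCast]
      congr 1
      rw [ha]; push_cast; field_simp; ring
    have h1 : (N * (4 * r)) ^ 2 =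
        16 * ((d : ℝ) ^ (3 / 4 : ℝ)) ^ 2 * (N : ℝ) ^ (1 - 1 / d : ℝ) * A := by
      rw [hr]
      simp only [mul_pow, div_pow]
      rw [hNa, Real.sq_sqrt hA0.le]
      field_simp
      norm_num
    rw [le_div_iff₀ hK0, h1, hK]
    have h2 : 0 < (N : ℝ) ^ (1 - 1 / d : ℝ) := by positivity
    nlinarith [mul_pos h2 hA0, mul_le_mul_of_nonneg_right hd34' (mul_pos h2 hA0).le]
  let pt : (Fin d → Fin (N + 1)) → Fin d → ℝ := fun g j => ((g j : ℕ) : ℝ) / N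
  have hpt : ∀ g, pt g ≤ 1 := fun g j =>
    (div_le_one hN0).mpr (by exact_mod_cast Nat.lt_succ_iff.mp (g j).isLt)
  let bad : (Fin d → Fin (N + 1)) → Set Ω := fun g =>
    {ω | N * (4 * r) ≤ |N * volume.real (Icc 0 (pt g)) - boxCount (fun i => X i ω) (pt g)|}
  have hbad : ∀ g, μ.real (bad g) ≤ (1 - q) / ((N : ℝ) + 1) ^ d := by
    intro g
    refine (hX.measureReal_deviation_le hH hN (hpt g) (by positivity)
      (hH.card_crossing_le_rpow hN (pt g))).trans ?_
    have h1 : Real.exp (-(2 * (N * (4 * r)) ^ 2 / K)) ≤ (Real.exp A)⁻¹ := by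
      rw [← Real.exp_neg]
      exact Real.exp_le_exp.mpr (by linarith)
    have h2 : ((N : ℝ) + 1) ^ d * (2 / (1 - q)) ≤ Real.exp A := by
      rw [hA, Real.exp_add, Real.exp_nat_mul, Real.exp_log (by positivity)]
      gcongr
      exact two_div_le_exp_discConst hd hq1
    calc 2 * Real.exp (-(2 * (N * (4 * r)) ^ 2 / K)) ≤ 2 * (Real.exp A)⁻¹ := by gcongr
      _ ≤ 2 * (((N : ℝ) + 1) ^ d * (2 / (1 - q)))⁻¹ := by gcongr
      _ = (1 - q) / ((N : ℝ) + 1) ^ d := by field_simp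
  have hunion : μ.real (⋃ g, bad g) ≤ 1 - q := by
    refine (measureReal_iUnion_fintype_le _).trans ((Finset.sum_le_sum fun g _ => hbad g).trans ?_)
    simp only [Finset.sum_const, Finset.card_univ, Fintype.card_pi, Fintype.card_fin,
      Finset.prod_const, nsmul_eq_mul]
    push_cast
    rw [mul_div_cancel₀ _ (by positivity)]
  have hgood : (⋃ g, bad g)ᶜ ⊆ {ω | starDiscrepancy (fun i => X i ω) ≤ discBound d q N} := by
    intro ω hω
    have h1 := starDiscrepancy_le_of_grid hN (fun i => X i ω) (δ := 4 * r) fun g => by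
      have h2 : ¬ N * (4 * r) ≤
          |N * volume.real (Icc 0 (pt g)) - boxCount (fun i => X i ω) (pt g)| :=
        fun h => hω (mem_iUnion.mpr ⟨g, h⟩)
      have h3 : volume.real (Icc 0 (pt g)) - boxCount (fun i => X i ω) (pt g) / N =
          (N * volume.real (Icc 0 (pt g)) - boxCount (fun i => X i ω) (pt g)) / N := by
        field_simp
      change |volume.real (Icc 0 (pt g)) - boxCount (fun i => X i ω) (pt g) / N| ≤ 4 * r
      rw [h3, abs_div, abs_of_pos hN0, div_le_iff₀ hN0]
      linarith
    show starDiscrepancy (fun i => X i ω) ≤ discBound d q N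
    linarith
  have hcompl : ENNReal.ofReal q ≤ μ (⋃ g, bad g)ᶜ := by
    have h1 : (1 : ENNReal) ≤ μ (⋃ g, bad g) + μ (⋃ g, bad g)ᶜ := by
      rw [← measure_univ (μ := μ), ← union_compl_self (⋃ g, bad g)]
      exact measure_union_le _ _
    rw [← ofReal_measureReal, ← ofReal_measureReal (s := (⋃ g, bad g)ᶜ),
      ← ENNReal.ofReal_add measureReal_nonneg measureReal_nonneg, ENNReal.one_le_ofReal] at h1
    rw [← ofReal_measureReal]
    exact ENNReal.ofReal_le_ofReal (by linarith)
  exact hcompl.trans (measure_mono hgood)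

end IsHilbertSample

/-! ### The order of the bound -/

theorem discBound_isBigO {d : ℕ} (hd : 1 ≤ d) {q : ℝ} (hq0 : 0 ≤ q) (hq1 : q < 1) :
    (fun N : ℕ => discBound d q N) =O[Filter.atTop]
      (fun N : ℕ => (N : ℝ) ^ (-(1 / 2) - 1 / (2 * d) : ℝ) * √(Real.log N)) := by
  have hd' : (1 : ℝ) ≤ d := by exact_mod_cast hd
  have hc : 0 ≤ discConst d q := (Real.log_nonneg one_le_two).trans
    (log_two_le_discConst hd hq0 hq1)
  set c := discConst d q with hcdef
  refine Asymptotics.IsBigO.of_bound (6 * (d : ℝ) ^ (3 / 4 : ℝ) * √(2 * d + c) + c) ?_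
  filter_upwards [Filter.eventually_ge_atTop 3] with N hN
  have hN3 : (3 : ℝ) ≤ N := by exact_mod_cast hN
  have hN0 : (0 : ℝ) < N := by linarith
  have hlog : 1 ≤ Real.log N := by
    rw [Real.le_log_iff_exp_le hN0]
    linarith [Real.exp_one_lt_d9]
  have hlog' : Real.log (N + 1) ≤ 2 * Real.log N := by
    rw [← Real.log_rpow hN0]
    apply Real.log_le_log (by positivity)
    rw [Real.rpow_two]
    nlinarith
  have hsqrt : √(d * Real.log (N + 1) + c) ≤ √(2 * d + c) * √(Real.log N) := by
    rw [← Real.sqrt_mul (by positivity)]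
    apply Real.sqrt_le_sqrt
    nlinarith
  set P : ℝ := (N : ℝ) ^ (-(1 / 2) - 1 / (2 * d) : ℝ) with hP
  have hP0 : 0 < P := by positivity
  have hPinv : P = ((N : ℝ) ^ (1 / 2 + 1 / (2 * d) : ℝ))⁻¹ := by
    rw [hP, ← Real.rpow_neg hN0.le]; congr 1; ring
  have hPN : 1 / (N : ℝ) ≤ P := by
    rw [one_div, ← Real.rpow_neg_one]
    apply Real.rpow_le_rpow_of_exponent_le (by linarith)
    have : 1 / (2 * (d : ℝ)) ≤ 1 / 2 := one_div_le_one_div_of_le two_pos (by linarith)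
    linarith
  have hs1 : 1 ≤ √(Real.log N) := Real.one_le_sqrt.mpr hlog
  have hB : discBound d q N =
      6 * (d : ℝ) ^ (3 / 4 : ℝ) * P * √(d * Real.log (N + 1) + c) + 2 / 3 * c * (1 / N) := by
    rw [discBound, ← hcdef, hPinv]; ring
  have hB0 : 0 ≤ discBound d q N := by rw [hB]; positivity
  rw [Real.norm_of_nonneg hB0, Real.norm_of_nonneg (by positivity), hB]
  have h1 : 2 / 3 * c * (1 / N) ≤ c * (P * √(Real.log N)) := by
    calc 2 / 3 * c * (1 / N) ≤ 1 * c * P := by gcongr; norm_num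
      _ = c * (P * 1) := by ring
      _ ≤ c * (P * √(Real.log N)) := by gcongr
  calc _ ≤ 6 * (d : ℝ) ^ (3 / 4 : ℝ) * P * (√(2 * d + c) * √(Real.log N)) +
        c * (P * √(Real.log N)) := by gcongr
    _ = _ := by ring

theorem mainTheorem1 (d : ℕ) (hd : 1 ≤ d) (q : ℝ) (hq0 : 0 ≤ q) (hq1 : q < 1) :
    (∀ (b m : ℕ), 1 ≤ b → 1 ≤ m →
      ∀ (H : ℝ → Fin d → ℝ), IsHilbertCurve d H →
      ∀ (Ω : Type*) [MeasurableSpace Ω] (μ : Measure Ω) [IsProbabilityMeasure μ]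
        (X : Fin (b ^ m) → Ω → Fin d → ℝ), IsHilbertSample H μ X →
      ENNReal.ofReal q ≤
        μ {ω | starDiscrepancy (fun i => X i ω) ≤ discBound d q (b ^ m)}) ∧
    (fun N : ℕ => discBound d q N) =O[Filter.atTop]
      (fun N : ℕ => (N : ℝ) ^ (-(1 / 2) - 1 / (2 * d) : ℝ) * √(Real.log N)) := by
  refine ⟨?_, discBound_isBigO hd hq0 hq1⟩
  intro b m hb _ H hH Ω _ μ _ X hX
  have : NeZero d := ⟨by omega⟩
  exact hX.ofReal_le_measure_starDiscrepancy_le hH (Nat.pow_pos hb) hq0 hq1
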